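/- The equation $$\frac{2^{\sigma+1}}{4^{\sigma}-1}\,\log 2=-\frac{\zeta'(\sigma)}{\zeta(\sigma)}$$ has exactly one real solution $\sigma>1$; denote it by $E$. Call $b\in\mathbb{C}\setminus\{1\}$ a turning point of the Riemann zeta function $\zeta$ if $\operatorname{Im}\zeta(b)=0$ and $\operatorname{Re}\zeta'(b)=0$. Then every turning point $b$ of $\zeta$ satisfies $\operatorname{Re} b<E$ (in particular $\operatorname{Re} b\le E$), and there is a sequence $(b_k)$ of turning points of $\zeta$ with $\lim_{k\to\infty}\operatorname{Re} b_k=E$. -/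

import Mathlib

open Filter Topology

/-- A turning point of the Riemann zeta function: a point `b` of its domain `ℂ ∖ {1}` at which
`Im ζ(b) = 0` and `Re ζ'(b) = 0`.  (At the pole Mathlib assigns `ζ` a finite default value, so
`b ≠ 1` is stated.) -/
def IsZetaTurningPoint (b : ℂ) : Prop :=
  b ≠ 1 ∧ (riemannZeta b).im = 0 ∧ (deriv riemannZeta b).re = 0

/-- The real number `σ` is a solution, in the range `σ > 1`, of the equation
`2 ^ (σ + 1) / (4 ^ σ - 1) * log 2 = - ζ'(σ) / ζ(σ)`. -/
def IsTitchmarshSolution (σ : ℝ) : Prop :=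
  1 < σ ∧
    (((2 : ℝ) ^ (σ + 1) / ((4 : ℝ) ^ σ - 1) * Real.log 2 : ℝ) : ℂ) =
      -(deriv riemannZeta (σ : ℂ) / riemannZeta (σ : ℂ))

/-!
Put `z = 2 ^ (-s)` and let `L` be the Dirichlet series of `-ζ'/ζ` restricted to odd integers. Where
`ζ(s)` is real and `Re s > 1`, a vertical tangent means `Re L(s) + log 2 * Re (z / (1 - z)) = 0`.
If `Re s ≥ E`, this is impossible: a real value of `ζ(s)` ties the phase of the Euler factor at `2`
to the phase of the other factors, and Cauchy-Schwarz bounds the latter phase by the deficiency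
`L(Re s) - |Re L(s)|`. The function `(1 + 2 ^ σ) * L(σ)` is strictly decreasing and takes the value
`log 2` exactly at `E`.

Conversely, by Kronecker's theorem there are vertical translates of `ζ` converging to the function
`ζ(s) * (1 - z) / (1 + z)`, whose curve `Im = 0` crosses the real axis downwards just to the left
of `E`, while the curve `Im ζ = 0` is crossed only upwards by the line `Re s = E` at the
corresponding heights. In between, some branch of the curve must turn.
-/

section Kronecker

open MeasureTheory

variable {d : Type*} [Fintype d]

theorem integrable_continuousMap_comp {α X : Type*} [TopologicalSpace α] [MeasurableSpace α]
    [OpensMeasurableSpace α] [TopologicalSpace X] [CompactSpace X] (μ : Measure α)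
    [IsFiniteMeasure μ] (f : C(X, ℂ)) {γ : α → X} (hγ : Continuous γ) :
    Integrable (fun a => f (γ a)) μ :=
  .of_bound (C := ‖f‖) (f.continuous.comp hγ).aestronglyMeasurable
    (.of_forall fun _ => f.norm_coe_le_norm _)

theorem lipschitzWith_integral_continuousMap_comp {α X : Type*} [TopologicalSpace α]
    [MeasurableSpace α] [OpensMeasurableSpace α] [TopologicalSpace X] [CompactSpace X]
    (μ : Measure α) [IsZeroOrProbabilityMeasure μ] {γ : α → X} (hγ : Continuous γ) :
    LipschitzWith 1 fun f : C(X, ℂ) => ∫ a, f (γ a) ∂μ := by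
  refine LipschitzWith.of_dist_le_mul fun f g => ?_
  rw [dist_eq_norm, ← integral_sub (integrable_continuousMap_comp μ f hγ)
    (integrable_continuousMap_comp μ g hγ), NNReal.coe_one, one_mul, dist_eq_norm]
  calc _ ≤ ‖f - g‖ * μ.real Set.univ :=
        norm_integral_le_of_norm_le_const (.of_forall fun a => (f - g).norm_coe_le_norm (γ a))
    _ ≤ ‖f - g‖ := mul_le_of_le_one_right (norm_nonneg _) measureReal_le_one

theorem tendsto_intervalAverage_exp (μ : ℝ) :
    Tendsto (fun T : ℝ => ⨍ t in (0 : ℝ)..T, Complex.exp (μ * Complex.I * t)) atTop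
      (𝓝 (if μ = 0 then 1 else 0)) := by
  split_ifs with h
  · refine tendsto_const_nhds.congr' ?_
    filter_upwards [eventually_gt_atTop 0] with T hT
    simp [h, interval_average_eq, hT.ne']
  have hμ : (μ * Complex.I : ℂ) ≠ 0 := mul_ne_zero (by exact_mod_cast h) Complex.I_ne_zero
  have hnorm (T : ℝ) : ‖Complex.exp (μ * Complex.I * T)‖ = 1 := by
    rw [mul_right_comm, ← Complex.ofReal_mul, Complex.norm_exp_ofReal_mul_I]
  refine squeeze_zero_norm (a := fun T => ‖T‖⁻¹ * ((1 + 1) / |μ|)) (fun T => ?_)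
    (by simpa using (tendsto_norm_atTop_atTop.inv_tendsto_atTop).mul_const ((1 + 1) / |μ|))
  rw [interval_average_eq, sub_zero, norm_smul, norm_inv, integral_exp_mul_complex hμ, norm_div,
    norm_mul (μ : ℂ), Complex.norm_I, mul_one, Complex.norm_real, Real.norm_eq_abs μ]
  gcongr
  exact (norm_sub_le _ _).trans_eq (by rw [hnorm, hnorm])

theorem integral_mFourier (n : d → ℤ) :
    ∫ x, UnitAddTorus.mFourier n x = if n = 0 then 1 else 0 := by
  have hprod := integral_fintype_prod_volume_eq_prod
    fun (i : d) (x : UnitAddCircle) => (fourier (n i) x : ℂ)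
  rw [show ∫ x, UnitAddTorus.mFourier n x = _ from hprod]
  split_ifs with hn
  · simp [hn, Measure.real]
  · obtain ⟨i, hi⟩ := Function.ne_iff.mp hn
    exact Finset.prod_eq_zero (Finset.mem_univ i) (integral_eq_zero_of_add_right_eq_neg
      (fourier_add_half_inv_index (T := 1) hi one_pos))

/-- The one-parameter subgroup `t ↦ t ν mod 1` of the torus. -/
def torusLine (ν : d → ℝ) (t : ℝ) : UnitAddTorus d := fun i => ((t * ν i : ℝ) : UnitAddCircle)

omit [Fintype d] in
theorem continuous_torusLine (ν : d → ℝ) : Continuous (torusLine ν) := by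
  unfold torusLine
  fun_prop

theorem mFourier_torusLine (n : d → ℤ) (ν : d → ℝ) (t : ℝ) :
    UnitAddTorus.mFourier n (torusLine ν t) =
      Complex.exp ((2 * Real.pi * ∑ i, n i * ν i : ℝ) * Complex.I * t) := by
  simp only [UnitAddTorus.mFourier, torusLine, ContinuousMap.coe_mk, fourier_coe_apply]
  rw [← Complex.exp_sum]
  push_cast
  simp_rw [Finset.mul_sum, Finset.sum_mul]
  exact congrArg _ (Finset.sum_congr rfl fun i _ => by ring)

/-- **Weyl's equidistribution theorem** -/
theorem tendsto_intervalAverage_torusLine {ν : d → ℝ} (hν : LinearIndependent ℤ ν)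
    (f : C(UnitAddTorus d, ℂ)) :
    Tendsto (fun T : ℝ => ⨍ t in (0 : ℝ)..T, f (torusLine ν t)) atTop (𝓝 (∫ x, f x)) := by
  classical
  have : IsProbabilityMeasure (volume : Measure UnitAddCircle) := ⟨UnitAddCircle.measure_univ⟩
  have hline := continuous_torusLine ν
  have hclosed := (LipschitzWith.uniformEquicontinuous
      (fun (T : ℝ) (f : C(UnitAddTorus d, ℂ)) => ⨍ t in (0 : ℝ)..T, f (torusLine ν t)) 1
      fun T => lipschitzWith_integral_continuousMap_comp _
        hline).equicontinuous.isClosed_setOfPred_tendsto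
    (l := atTop) (lipschitzWith_integral_continuousMap_comp volume continuous_id).continuous
  refine (Submodule.dense_iff_topologicalClosure_eq_top.mpr
    UnitAddTorus.span_mFourier_closure_eq_top).induction (fun f hf => ?_) hclosed f
  induction hf using Submodule.span_induction with
  | mem f hf =>
    obtain ⟨n, rfl⟩ := hf
    have hfreq : 2 * Real.pi * ∑ i, n i * ν i = 0 ↔ n = 0 := by
      refine ⟨fun h => funext (Fintype.linearIndependent_iff.mp hν n ?_), fun h => by simp [h]⟩
      simpa [Real.pi_ne_zero] using h
    simpa only [id, integral_mFourier, mFourier_torusLine, hfreq] using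
      tendsto_intervalAverage_exp (2 * Real.pi * ∑ i, n i * ν i)
  | zero => simp
  | add f g _ _ hf hg =>
    have hadd : ∫ x, (f + g) x = (∫ x, f x) + ∫ x, g x :=
      integral_add (integrable_continuousMap_comp volume f continuous_id)
        (integrable_continuousMap_comp volume g continuous_id)
    rw [hadd]
    exact (hf.add hg).congr fun T => (integral_add (integrable_continuousMap_comp _ f hline)
      (integrable_continuousMap_comp _ g hline)).symm
  | smul c f _ hf =>
    simp only [ContinuousMap.smul_apply]
    rw [integral_smul]
    exact (hf.const_smul c).congr fun T => (integral_smul c _).symm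

theorem denseRange_torusLine_of_finite {ι : Type*} [Finite ι] {ν : ι → ℝ}
    (hν : LinearIndependent ℤ ν) : DenseRange (torusLine ν) := by
  have := Fintype.ofFinite ι
  by_contra hdense
  obtain ⟨z, hz⟩ : ∃ z, z ∉ closure (Set.range (torusLine ν)) := by
    simpa [DenseRange, Dense] using hdense
  have hpos : 0 < ∫ x, Metric.infDist x (Set.range (torusLine ν)) :=
    (Metric.continuous_infDist_pt _).integral_pos_of_hasCompactSupport_nonneg_nonzero
      (.of_compactSpace _) (fun x => Metric.infDist_nonneg) (x := z)
      (by rwa [Ne, ← Metric.mem_closure_iff_infDist_zero (Set.range_nonempty _)])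
  have hlim := tendsto_intervalAverage_torusLine hν
    ⟨fun x => (Metric.infDist x (Set.range (torusLine ν)) : ℂ),
      Complex.continuous_ofReal.comp (Metric.continuous_infDist_pt _)⟩
  simp only [ContinuousMap.coe_mk, Metric.infDist_zero_of_mem (Set.mem_range_self _),
    integral_complex_ofReal, Complex.ofReal_zero] at hlim
  have hzero := tendsto_nhds_unique hlim
    (tendsto_const_nhds.congr fun T => (by simp : (0 : ℂ) = _))
  exact hpos.ne' (by exact_mod_cast hzero)

/-- **Kronecker's approximation theorem** -/
theorem denseRange_torusLine {ι : Type*} {ν : ι → ℝ} (hν : LinearIndependent ℤ ν) :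
    DenseRange (torusLine ν) := by
  refine dense_iff_inter_open.mpr fun U hU ⟨z, hz⟩ => ?_
  obtain ⟨I, V, hV, hVU⟩ := isOpen_pi_iff.mp hU z hz
  have hopen : IsOpen (Set.univ.pi fun i : I => V i) :=
    isOpen_set_pi Set.finite_univ fun i _ => (hV i i.2).1
  obtain ⟨t, ht⟩ := (denseRange_torusLine_of_finite
    (hν.comp ((↑) : I → ι) Subtype.val_injective)).exists_mem_open hopen
      ⟨fun i => z i, fun i _ => (hV i i.2).2⟩
  exact ⟨torusLine ν t, hVU fun i hi => ht ⟨i, hi⟩ trivial, t, rfl⟩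

theorem linearIndependent_log_primes : LinearIndependent ℤ fun p : Nat.Primes => Real.log p := by
  rw [linearIndependent_iff']
  intro s m hm q hq
  have hpos (p : Nat.Primes) : (0 : ℝ) < (p : ℕ) := by exact_mod_cast p.2.pos
  have hlog : Real.log (∏ p ∈ s, ((p : ℕ) : ℝ) ^ m p) = 0 := by
    rw [Real.log_prod fun p _ => (zpow_pos (hpos p) _).ne', ← hm]
    simp
  have hprod : ∏ p ∈ s, ((p : ℕ) : ℚ) ^ m p = 1 := Rat.cast_injective (α := ℝ) <| by
    simpa using Real.eq_one_of_pos_of_log_eq_zero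
      (Finset.prod_pos fun p _ => zpow_pos (hpos p) _) hlog
  have : Fact (q : ℕ).Prime := ⟨q.2⟩
  have hnorm : ∏ p ∈ s, ‖((p : ℕ) : ℚ_[q])‖ ^ m p = 1 := by
    simpa using congrArg (fun x : ℚ => ‖(x : ℚ_[q])‖) hprod
  rw [Finset.prod_eq_single_of_mem q hq fun p _ hpq => by
    rw [Padic.norm_natCast_eq_one_iff.mpr, one_zpow]
    exact (Nat.coprime_primes q.2 p.2).mpr fun h => hpq (Subtype.ext h.symm)] at hnorm
  rw [Padic.norm_p, inv_zpow, inv_eq_one] at hnorm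
  exact (zpow_eq_one_iff_right₀ (hpos q).le (by exact_mod_cast q.2.ne_one)).mp hnorm

end Kronecker

section Shifts

open LSeries

theorem exists_tendsto_cpow_of_prime (f : ℕ → ℂ) (hf : ∀ p : Nat.Primes, ‖f p‖ = 1) :
    ∃ T : ℕ → ℝ, ∀ p : Nat.Primes,
      Tendsto (fun k => ((p : ℕ) : ℂ) ^ (-(T k * Complex.I))) atTop (𝓝 (f p)) := by
  let circle := AddCircle.homeomorphCircle (T := (1 : ℝ)) one_ne_zero
  obtain ⟨z, hz⟩ : ∃ z : Nat.Primes → UnitAddCircle, ∀ p, (circle (z p) : ℂ) = f p :=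
    ⟨fun p => circle.symm ⟨f p, mem_sphere_zero_iff_norm.mpr (hf p)⟩, fun p =>
      congrArg Subtype.val (circle.apply_symm_apply _)⟩
  obtain ⟨x, hx, hlim⟩ := mem_closure_iff_seq_limit.mp
    (denseRange_torusLine linearIndependent_log_primes z)
  choose t ht using hx
  refine ⟨fun k => -(2 * Real.pi * t k), fun p => ?_⟩
  have hcircle : Tendsto (fun k => (circle (x k p) : ℂ)) atTop (𝓝 (circle (z p))) :=
    ((continuous_subtype_val.comp circle.continuous).tendsto _).comp (tendsto_pi_nhds.mp hlim _)
  rw [hz] at hcircle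
  refine hcircle.congr fun k => ?_
  rw [← ht, AddCircle.homeomorphCircle_apply, torusLine, AddCircle.toCircle_apply_mk,
    Circle.coe_exp, Complex.cpow_def_of_ne_zero (by exact_mod_cast p.2.ne_zero),
    ← Complex.natCast_log]
  congr 1
  push_cast
  ring

theorem exists_tendsto_cpow (f : ℕ →*₀ ℂ) (hf : ∀ n ≠ 0, ‖f n‖ = 1) :
    ∃ T : ℕ → ℝ, ∀ n : ℕ, n ≠ 0 →
      Tendsto (fun k => (n : ℂ) ^ (-(T k * Complex.I))) atTop (𝓝 (f n)) := by
  obtain ⟨T, hT⟩ := exists_tendsto_cpow_of_prime f fun p => hf p p.2.ne_zero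
  refine ⟨T, fun n => ?_⟩
  induction n using induction_on_primes with
  | zero => simp
  | one => simp
  | prime_mul p a hp ih =>
    intro hpa
    rw [map_mul]
    refine ((hT ⟨p, hp⟩).mul (ih (right_ne_zero_of_mul hpa))).congr fun k => ?_
    rw [Nat.cast_mul, Complex.natCast_mul_natCast_cpow]

theorem tendstoUniformlyOn_LSeries {ι : Type*} {l : Filter ι} {f : ι → ℕ → ℂ} {g : ℕ → ℂ} {C : ℝ}
    (hf : ∀ i, ∀ n ≠ 0, ‖f i n‖ ≤ C) (hg : ∀ n ≠ 0, ‖g n‖ ≤ C)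
    (hlim : ∀ n ≠ 0, Tendsto (f · n) l (𝓝 (g n))) {σ₀ : ℝ} (hσ₀ : 1 < σ₀) :
    TendstoUniformlyOn (fun i => LSeries (f i)) (LSeries g) l {s | σ₀ ≤ s.re} := by
  have hdiff (i : ι) (n : ℕ) (hn : n ≠ 0) : ‖(g - f i) n‖ ≤ C + C :=
    (norm_sub_le _ _).trans (add_le_add (hg n hn) (hf i n hn))
  have hdom : Summable fun n => ‖term (fun _ => ((C + C : ℝ) : ℂ)) σ₀ n‖ :=
    (LSeriesSummable_of_bounded_of_one_lt_re (fun _ _ => le_rfl) (by simpa)).norm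
  have hbound (i : ι) (n : ℕ) :
      ‖term (g - f i) σ₀ n‖ ≤ ‖term (fun _ => ((C + C : ℝ) : ℂ)) σ₀ n‖ := by
    rcases eq_or_ne n 0 with rfl | hn
    · simp
    · refine norm_term_le _ ((hdiff i n hn).trans ?_)
      rw [Complex.norm_real]
      exact le_abs_self _
  have hzero : Tendsto (fun i => ∑' n, ‖term (g - f i) σ₀ n‖) l (𝓝 0) := by
    rw [← tsum_zero (β := ℕ)]
    refine tendsto_tsum_of_dominated_convergence hdom (fun n => ?_)
      (.of_forall fun i n => (norm_norm _).trans_le (hbound i n))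
    rcases eq_or_ne n 0 with rfl | hn
    · simpa using tendsto_const_nhds
    have := (((hlim n hn).const_sub (g n)).div_const ((n : ℂ) ^ (σ₀ : ℂ))).norm
    simpa [term_of_ne_zero hn] using this
  refine Metric.tendstoUniformlyOn_iff.mpr fun ε hε => ?_
  filter_upwards [hzero.eventually_lt_const hε] with i hi s hs
  have hs1 : 1 < s.re := hσ₀.trans_le hs
  have hsum : Summable fun n => ‖term (g - f i) s n‖ :=
    (LSeriesSummable_of_bounded_of_one_lt_re (hdiff i) hs1).norm
  calc dist (LSeries g s) (LSeries (f i) s) = ‖LSeries (g - f i) s‖ := by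
        rw [dist_eq_norm, LSeries_sub (LSeriesSummable_of_bounded_of_one_lt_re hg hs1)
          (LSeriesSummable_of_bounded_of_one_lt_re (hf i) hs1)]
    _ ≤ ∑' n, ‖term (g - f i) s n‖ := norm_tsum_le_tsum_norm hsum
    _ ≤ ∑' n, ‖term (g - f i) σ₀ n‖ := hsum.tsum_le_tsum
        (norm_term_le_of_re_le_re _ (by simpa))
        (hdom.of_nonneg_of_le (fun _ => norm_nonneg _) (hbound i))
    _ < ε := hi

theorem term_one_add (s w : ℂ) : term 1 (s + w) = term (fun n => (n : ℂ) ^ (-w)) s := by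
  ext n
  rcases eq_or_ne n 0 with rfl | hn
  · simp
  · rw [term_of_ne_zero hn, term_of_ne_zero hn, Complex.cpow_add _ _ (by exact_mod_cast hn),
      Complex.cpow_neg, Pi.one_apply, one_div, mul_inv, div_eq_mul_inv, mul_comm]

theorem exists_tendstoUniformlyOn_riemannZeta_add_mul_I (f : ℕ →*₀ ℂ) (hf : ∀ n ≠ 0, ‖f n‖ = 1) :
    ∃ T : ℕ → ℝ, (∀ n : ℕ, n ≠ 0 →
      Tendsto (fun k => (n : ℂ) ^ (-(T k * Complex.I))) atTop (𝓝 (f n))) ∧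
      ∀ σ₀ > 1, TendstoUniformlyOn (fun k s => riemannZeta (s + T k * Complex.I)) (LSeries f) atTop
        {s | σ₀ ≤ s.re} := by
  obtain ⟨T, hT⟩ := exists_tendsto_cpow f hf
  refine ⟨T, hT, fun σ₀ hσ₀ => ?_⟩
  have hnorm (k n : ℕ) (hn : n ≠ 0) : ‖(n : ℂ) ^ (-(T k * Complex.I))‖ ≤ 1 := by
    rw [Complex.norm_natCast_cpow_of_pos (Nat.pos_of_ne_zero hn)]
    simp
  refine (tendstoUniformlyOn_LSeries hnorm (fun n hn => (hf n hn).le) hT hσ₀).congr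
    (.of_forall fun k s hs => ?_)
  have hs1 : 1 < (s + T k * Complex.I).re := by simpa using hσ₀.trans_le hs
  exact (congrArg tsum (term_one_add s _)).symm.trans (LSeries_one_eq_riemannZeta hs1)

/-- The completely multiplicative function with value `c` at the prime `p` and `1` at all others. -/
def primeTwist (p : ℕ) (c : ℂ) : ℕ →*₀ ℂ where
  toFun n := if n = 0 then 0 else c ^ n.factorization p
  map_zero' := if_pos rfl
  map_one' := by simp
  map_mul' m n := by
    by_cases hm : m = 0
    · simp [hm]
    by_cases hn : n = 0
    · simp [hn]
    simp [hm, hn, Nat.factorization_mul hm hn, pow_add]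

theorem primeTwist_apply {p n : ℕ} (c : ℂ) (hn : n ≠ 0) :
    primeTwist p c n = c ^ n.factorization p := if_neg hn

theorem primeTwist_self {p : ℕ} (hp : p.Prime) (c : ℂ) : primeTwist p c p = c := by
  simp [primeTwist_apply c hp.ne_zero, hp.factorization_self]

theorem primeTwist_of_not_dvd {p n : ℕ} (c : ℂ) (h : ¬p ∣ n) : primeTwist p c n = 1 := by
  rw [primeTwist_apply c (by rintro rfl; exact h (dvd_zero p)),
    Nat.factorization_eq_zero_of_not_dvd h, pow_zero]

theorem norm_primeTwist {p n : ℕ} {c : ℂ} (hc : ‖c‖ = 1) (hn : n ≠ 0) : ‖primeTwist p c n‖ = 1 := by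
  simp [primeTwist_apply c hn, hc]

theorem one_sub_mul_tsum_eq_tsum_not_dvd {p : ℕ} (hp : p ≠ 0) (f : ℕ →*₀ ℂ) (hf : Summable f) :
    (1 - f p) * ∑' n, f n = ∑' n, if p ∣ n then 0 else f n := by
  have hmultiples : HasSum (fun n => if p ∣ n then f n else 0) (f p * ∑' n, f n) := by
    refine (Function.Injective.hasSum_iff (mul_right_injective₀ hp) fun n hn =>
      if_neg fun ⟨k, hk⟩ => hn ⟨k, hk.symm⟩).mp ?_
    simpa [Function.comp_def] using hf.hasSum.mul_left (f p)
  rw [sub_mul, one_mul, ← (hf.hasSum.sub hmultiples).tsum_eq]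
  exact tsum_congr fun n => by split_ifs <;> simp

theorem one_sub_mul_LSeries_eq {p : ℕ} (hp : p ≠ 0) (f : ℕ →*₀ ℂ) {s : ℂ}
    (hs : LSeriesSummable f s) (hs0 : s ≠ 0) : (1 - f p * (p : ℂ) ^ (-s)) * LSeries f s =
      LSeries (fun n => if p ∣ n then 0 else f n) s := by
  have hterm (n : ℕ) : (f * riemannZetaSummandHom hs0) n = term f s n := by
    rw [term_of_ne_zero' hs0, div_eq_mul_inv, ← Complex.cpow_neg]
    rfl
  have heuler := one_sub_mul_tsum_eq_tsum_not_dvd hp (f * riemannZetaSummandHom hs0)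
    (hs.congr fun n => (hterm n).symm)
  simp only [hterm] at heuler
  rw [term_of_ne_zero hp, div_eq_mul_inv, ← Complex.cpow_neg] at heuler
  refine heuler.trans (tsum_congr fun n => ?_)
  rw [term_of_ne_zero' hs0, term_of_ne_zero' hs0]
  split_ifs <;> simp

theorem LSeries_primeTwist {p : ℕ} (hp : p.Prime) {c s : ℂ} (hc : ‖c‖ = 1) (hs : 1 < s.re) :
    (1 - c * (p : ℂ) ^ (-s)) * LSeries (primeTwist p c) s =
      (1 - (p : ℂ) ^ (-s)) * riemannZeta s := by
  have heuler {c : ℂ} (hc : ‖c‖ = 1) : (1 - c * (p : ℂ) ^ (-s)) * LSeries (primeTwist p c) s =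
      LSeries (fun n => if p ∣ n then 0 else 1) s := by
    have h := one_sub_mul_LSeries_eq hp.ne_zero (primeTwist p c)
      (LSeriesSummable_of_bounded_of_one_lt_re (fun n hn => (norm_primeTwist hc hn).le) hs)
      (Complex.ne_zero_of_one_lt_re hs)
    rw [primeTwist_self hp] at h
    refine h.trans (LSeries_congr (fun {n} _ => ?_) s)
    split_ifs with hn
    · rfl
    · exact primeTwist_of_not_dvd c hn
  have hone : LSeries (primeTwist p 1) s = riemannZeta s :=
    (LSeries_congr (fun hn => by simp [primeTwist_apply 1 hn]) s).trans
      (LSeries_one_eq_riemannZeta hs)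
  rw [heuler hc, ← heuler norm_one, hone, one_mul]

end Shifts

section LogLSeries

open LSeries ArithmeticFunction
open scoped LSeries.notation

theorem isOpen_one_lt_re : IsOpen {s : ℂ | 1 < s.re} :=
  isOpen_lt continuous_const Complex.continuous_re

theorem norm_vonMangoldt_div_log_le_one (n : ℕ) : ‖((vonMangoldt n / Real.log n : ℝ) : ℂ)‖ ≤ 1 := by
  rw [Complex.norm_real, Real.norm_of_nonneg
    (div_nonneg vonMangoldt_nonneg (Real.log_natCast_nonneg n))]
  exact div_le_one_of_le₀ vonMangoldt_le_log (Real.log_natCast_nonneg n)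

variable {N : ℕ} (χ : DirichletCharacter ℂ N)

/-- The Dirichlet series of the branch of `log L(s, χ)` that vanishes at infinity, with
coefficients `χ(n) Λ(n) / log n`. -/
noncomputable def logLSeries (s : ℂ) : ℂ :=
  LSeries (fun n => χ n * (vonMangoldt n / Real.log n : ℝ)) s

theorem abscissaOfAbsConv_logLSeries_le :
    abscissaOfAbsConv (fun n => χ n * (vonMangoldt n / Real.log n : ℝ)) ≤ 1 :=
  abscissaOfAbsConv_le_of_le_const ⟨1, fun n _ => (norm_mul_le _ _).trans
    (mul_le_one₀ (χ.norm_le_one _) (norm_nonneg _) (norm_vonMangoldt_div_log_le_one n))⟩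

theorem abscissaOfAbsConv_logLSeries_lt {x : EReal} (hx : 1 < x) :
    abscissaOfAbsConv (fun n => χ n * (vonMangoldt n / Real.log n : ℝ)) < x :=
  (abscissaOfAbsConv_logLSeries_le χ).trans_lt hx

theorem hasDerivAt_logLSeries {s : ℂ} (hs : 1 < s.re) :
    HasDerivAt (logLSeries χ) (-LSeries (↗χ * ↗vonMangoldt) s) s := by
  have h := LSeries_hasDerivAt (abscissaOfAbsConv_logLSeries_lt χ (x := s.re)
    (by exact_mod_cast hs))
  convert! h using 2
  refine LSeries_congr (fun {n} _ => ?_) s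
  rcases eq_or_ne (Real.log n) 0 with h0 | h0
  · simp [logMul, le_antisymm (vonMangoldt_le_log.trans h0.le) vonMangoldt_nonneg, h0]
  · rw [logMul, ← Complex.natCast_log, mul_left_comm, ← Complex.ofReal_mul, mul_div_cancel₀ _ h0,
      Pi.mul_apply]

theorem hasDerivAt_LSeries_dirichletCharacter (hN : N ≠ 0) {s : ℂ} (hs : 1 < s.re) :
    HasDerivAt (LSeries ↗χ) (-LSeries (↗χ * ↗vonMangoldt) s * LSeries ↗χ s) s := by
  have habs : abscissaOfAbsConv ↗χ < s.re := by
    rw [DirichletCharacter.absicssaOfAbsConv_eq_one hN]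
    exact_mod_cast hs
  rw [DirichletCharacter.LSeries_twist_vonMangoldt_eq χ hs, neg_div, neg_neg,
    div_mul_cancel₀ _ (DirichletCharacter.LSeries_ne_zero_of_one_lt_re χ hs)]
  exact (LSeries_hasDerivAt habs).differentiableAt.hasDerivAt

theorem exp_logLSeries (hN : N ≠ 0) {s : ℂ} (hs : 1 < s.re) :
    Complex.exp (logLSeries χ s) = LSeries ↗χ s := by
  let quotient (z : ℂ) : ℂ := LSeries ↗χ z * Complex.exp (-logLSeries χ z)
  have hderiv (z : ℂ) (hz : 1 < z.re) : HasDerivAt quotient 0 z := by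
    convert! (hasDerivAt_LSeries_dirichletCharacter χ hN hz).mul
      (hasDerivAt_logLSeries χ hz).fun_neg.cexp using 1
    ring
  have hconst (x : ℂ) (hx : 1 < x.re) : quotient x = quotient s :=
    isOpen_one_lt_re.is_const_of_deriv_eq_zero (convex_halfSpace_re_gt 1).isPreconnected
      (fun z hz => (hderiv z hz).differentiableAt.differentiableWithinAt)
      (fun z hz => (hderiv z hz).deriv) hx hs
  have hlim : Tendsto (fun x : ℝ => quotient x) atTop (𝓝 1) := by
    have hlog := LSeries.tendsto_atTop
      (abscissaOfAbsConv_logLSeries_lt χ (EReal.coe_lt_top 1))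
    have hL := LSeries.tendsto_atTop (f := ↗χ) (by
      rw [DirichletCharacter.absicssaOfAbsConv_eq_one hN]
      exact EReal.coe_lt_top 1)
    simpa [quotient, logLSeries] using hL.mul hlog.neg.cexp
  have hone : quotient s = 1 := tendsto_nhds_unique
    (tendsto_const_nhds.congr' (by
      filter_upwards [eventually_gt_atTop 1] with x hx using (hconst x (by simpa)).symm)) hlim
  rw [eq_comm, ← mul_inv_eq_one₀ (Complex.exp_ne_zero _), ← Complex.exp_neg]
  exact hone

theorem natCast_cpow_neg_eq {n : ℕ} (hn : n ≠ 0) (s : ℂ) :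
    (n : ℂ) ^ (-s) =
      ((n : ℝ) ^ (-s.re) : ℝ) * Complex.exp ((-(s.im * Real.log n) : ℝ) * Complex.I) := by
  have hn' : (n : ℂ) ≠ 0 := by exact_mod_cast hn
  rw [Complex.ofReal_cpow n.cast_nonneg, Complex.ofReal_natCast, Complex.cpow_def_of_ne_zero hn',
    Complex.cpow_def_of_ne_zero hn', ← Complex.exp_add, ← Complex.natCast_log]
  congr 1
  conv_lhs => rw [← Complex.re_add_im s]
  push_cast
  ring

theorem term_ofReal_eq (w : ℕ → ℝ) {s : ℂ} (hs : s.re ≠ 0) (n : ℕ) :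
    term (fun n => (w n : ℂ)) s n = (w n * (n : ℝ) ^ (-s.re) : ℝ) *
      Complex.exp ((-(s.im * Real.log n) : ℝ) * Complex.I) := by
  rcases eq_or_ne n 0 with rfl | hn
  · simp [Real.zero_rpow (neg_ne_zero.mpr hs)]
  · rw [term_of_ne_zero hn, div_eq_mul_inv, ← Complex.cpow_neg, natCast_cpow_neg_eq hn,
      Complex.ofReal_mul, mul_assoc]

theorem hasSum_re_LSeries {w : ℕ → ℝ} {s : ℂ} (hs : s.re ≠ 0)
    (h : LSeriesSummable (fun n => (w n : ℂ)) s) :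
    HasSum (fun n : ℕ => w n * (n : ℝ) ^ (-s.re) * Real.cos (s.im * Real.log n))
      (LSeries (fun n => (w n : ℂ)) s).re := by
  convert! Complex.hasSum_re h.hasSum using 2 with n
  rw [term_ofReal_eq w hs, Complex.re_ofReal_mul, Complex.exp_ofReal_mul_I_re, Real.cos_neg]

theorem hasSum_im_LSeries {w : ℕ → ℝ} {s : ℂ} (hs : s.re ≠ 0)
    (h : LSeriesSummable (fun n => (w n : ℂ)) s) :
    HasSum (fun n : ℕ => -(w n * (n : ℝ) ^ (-s.re) * Real.sin (s.im * Real.log n)))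
      (LSeries (fun n => (w n : ℂ)) s).im := by
  convert! Complex.hasSum_im h.hasSum using 2 with n
  rw [term_ofReal_eq w hs, Complex.im_ofReal_mul, Complex.exp_ofReal_mul_I_im, Real.sin_neg,
    mul_neg]

end LogLSeries

section OddPart

open LSeries

/-- The restriction of the von Mangoldt function to odd integers. -/
noncomputable def oddMangoldt (n : ℕ) : ℝ := if Even n then 0 else ArithmeticFunction.vonMangoldt n

theorem oddMangoldt_nonneg (n : ℕ) : 0 ≤ oddMangoldt n := by
  unfold oddMangoldt
  split_ifs
  exacts [le_rfl, ArithmeticFunction.vonMangoldt_nonneg]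

theorem oddMangoldt_le_log (n : ℕ) : oddMangoldt n ≤ Real.log n := by
  unfold oddMangoldt
  split_ifs
  exacts [Real.log_natCast_nonneg n, ArithmeticFunction.vonMangoldt_le_log]

theorem oddMangoldt_eq_zero_of_lt {n : ℕ} (h : n < 3) : oddMangoldt n = 0 := by
  interval_cases n <;> simp [oddMangoldt]

theorem oddMangoldt_prime_pos {p : ℕ} (hp : p.Prime) (h2 : p ≠ 2) : 0 < oddMangoldt p := by
  rw [oddMangoldt, if_neg (Nat.not_even_iff_odd.mpr (hp.odd_of_ne_two h2)),
    ArithmeticFunction.vonMangoldt_apply_prime hp]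
  exact Real.log_pos (by exact_mod_cast hp.one_lt)

theorem oddMangoldt_mul_rpow_nonneg (σ : ℝ) (n : ℕ) : 0 ≤ oddMangoldt n * (n : ℝ) ^ (-σ) :=
  mul_nonneg (oddMangoldt_nonneg n) (Real.rpow_nonneg n.cast_nonneg _)

theorem dirichletCharacter_two_one_mul (f : ℕ → ℝ) (n : ℕ) :
    (1 : DirichletCharacter ℂ 2) n * (f n : ℂ) = (if Even n then 0 else f n : ℝ) := by
  split_ifs with h
  · rw [MulChar.map_nonunit _ (by
      rwa [ZMod.isUnit_iff_coprime, Nat.coprime_two_right, Nat.not_odd_iff_even]),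
      zero_mul, Complex.ofReal_zero]
  · rw [MulChar.one_apply (by
      rwa [ZMod.isUnit_iff_coprime, Nat.coprime_two_right, ← Nat.not_even_iff_odd]),
      one_mul]

/-- The zeta function with its Euler factor at `2` removed. -/
noncomputable def oddZeta (s : ℂ) : ℂ := (1 - 2 ^ (-s)) * riemannZeta s

/-- The logarithmic derivative `-oddZeta' / oddZeta`, as a Dirichlet series. -/
noncomputable def oddLogDeriv (s : ℂ) : ℂ := LSeries (fun n => (oddMangoldt n : ℂ)) s

/-- The logarithm of `oddZeta` that vanishes at infinity, as a Dirichlet series. -/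
noncomputable def oddLog (s : ℂ) : ℂ := LSeries (fun n => (oddMangoldt n / Real.log n : ℝ)) s

theorem oddZeta_eq_LSeries {s : ℂ} (hs : 1 < s.re) :
    oddZeta s = LSeries ((1 : DirichletCharacter ℂ 2) ·) s := by
  have hs1 : s ≠ 1 := fun h => by simp [h] at hs
  rw [← DirichletCharacter.LFunction_eq_LSeries _ hs, ← DirichletCharacter.LFunctionTrivChar,
    DirichletCharacter.LFunctionTrivChar_eq_mul_riemannZeta hs1, Nat.prime_two.primeFactors]
  simp [oddZeta]

theorem twist_vonMangoldt_eq_oddMangoldt : ((fun n : ℕ => (1 : DirichletCharacter ℂ 2) n) *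
    fun n : ℕ => (ArithmeticFunction.vonMangoldt n : ℂ)) = fun n => (oddMangoldt n : ℂ) :=
  funext fun n => dirichletCharacter_two_one_mul ArithmeticFunction.vonMangoldt n

theorem coeff_logLSeries_one_two : (fun n : ℕ => (1 : DirichletCharacter ℂ 2) n *
      ((ArithmeticFunction.vonMangoldt n / Real.log n : ℝ) : ℂ)) =
    fun n => ((oddMangoldt n / Real.log n : ℝ) : ℂ) :=
  funext fun n => (dirichletCharacter_two_one_mul
    (fun n => ArithmeticFunction.vonMangoldt n / Real.log n) n).trans
      (by unfold oddMangoldt; split_ifs <;> simp)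

theorem LSeriesSummable_oddMangoldt {s : ℂ} (hs : 1 < s.re) :
    LSeriesSummable (fun n => (oddMangoldt n : ℂ)) s := by
  rw [← twist_vonMangoldt_eq_oddMangoldt]
  exact DirichletCharacter.LSeriesSummable_twist_vonMangoldt _ hs

theorem LSeriesSummable_oddMangoldt_div_log {s : ℂ} (hs : 1 < s.re) :
    LSeriesSummable (fun n => ((oddMangoldt n / Real.log n : ℝ) : ℂ)) s := by
  rw [← coeff_logLSeries_one_two]
  exact LSeriesSummable_of_abscissaOfAbsConv_lt_re
    (abscissaOfAbsConv_logLSeries_lt 1 (by exact_mod_cast hs))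

theorem hasSum_re_oddLogDeriv {s : ℂ} (hs : 1 < s.re) :
    HasSum (fun n : ℕ => oddMangoldt n * (n : ℝ) ^ (-s.re) * Real.cos (s.im * Real.log n))
      (oddLogDeriv s).re :=
  hasSum_re_LSeries (by positivity) (LSeriesSummable_oddMangoldt hs)

theorem hasSum_im_oddLog {s : ℂ} (hs : 1 < s.re) :
    HasSum (fun n : ℕ => -(oddMangoldt n / Real.log n * (n : ℝ) ^ (-s.re) *
      Real.sin (s.im * Real.log n))) (oddLog s).im :=
  hasSum_im_LSeries (by positivity) (LSeriesSummable_oddMangoldt_div_log hs)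

theorem hasSum_oddLogDeriv_ofReal {σ : ℝ} (hσ : 1 < σ) :
    HasSum (fun n : ℕ => oddMangoldt n * (n : ℝ) ^ (-σ)) (oddLogDeriv σ).re := by
  simpa using hasSum_re_oddLogDeriv (s := σ) (by simpa)

theorem oddLogDeriv_ofReal_im {σ : ℝ} (hσ : 1 < σ) : (oddLogDeriv σ).im = 0 :=
  HasSum.unique (hasSum_im_LSeries (by rw [Complex.ofReal_re]; positivity)
    (LSeriesSummable_oddMangoldt (by simpa))) (by simp [hasSum_zero])

theorem oddZeta_ne_zero {s : ℂ} (hs : 1 < s.re) : oddZeta s ≠ 0 := by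
  rw [oddZeta_eq_LSeries hs]
  exact DirichletCharacter.LSeries_ne_zero_of_one_lt_re _ hs

theorem hasDerivAt_oddZeta {s : ℂ} (hs : 1 < s.re) :
    HasDerivAt oddZeta (-oddLogDeriv s * oddZeta s) s := by
  rw [oddZeta_eq_LSeries hs, oddLogDeriv, ← twist_vonMangoldt_eq_oddMangoldt]
  refine (hasDerivAt_LSeries_dirichletCharacter 1 two_ne_zero hs).congr_of_eventuallyEq ?_
  filter_upwards [isOpen_one_lt_re.mem_nhds hs] with z hz using oddZeta_eq_LSeries hz

theorem exp_oddLog {s : ℂ} (hs : 1 < s.re) : Complex.exp (oddLog s) = oddZeta s := by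
  rw [oddZeta_eq_LSeries hs, ← exp_logLSeries 1 two_ne_zero hs, logLSeries,
    coeff_logLSeries_one_two, oddLog]

end OddPart

section WeightedTrigonometricSums

variable {ι : Type*} {w φ : ι → ℝ} {W C : ℝ}

theorem sq_le_two_mul_mul_sub_abs_of_hasSum {l : ι → ℝ} {S K : ℝ} (hw : ∀ i, 0 ≤ w i)
    (hW : HasSum w W) (hC : HasSum (fun i => w i * Real.cos (φ i)) C)
    (hS : HasSum (fun i => w i * (l i * Real.sin (φ i))) S)
    (hK : HasSum (fun i => w i * l i ^ 2) K) : S ^ 2 ≤ 2 * K * (W - |C|) := by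
  have hbound (ε : ℝ) (hε : ε ^ 2 = 1) : S ^ 2 ≤ 2 * K * (W - ε * C) := by
    have hquad (x : ℝ) : 0 ≤ K * (x * x) + -2 * S * x + 2 * (W - ε * C) := by
      refine HasSum.nonneg (fun i => ?_) (((hK.mul_right (x * x)).add
        ((hS.mul_left (-2)).mul_right x)).add ((hW.sub (hC.mul_left ε)).mul_left 2))
      have hterm : w i * l i ^ 2 * (x * x) + -2 * (w i * (l i * Real.sin (φ i))) * x +
          2 * (w i - ε * (w i * Real.cos (φ i))) =
          w i * ((Real.sin (φ i) - x * l i) ^ 2 + (1 - ε * Real.cos (φ i)) ^ 2) := by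
        linear_combination -w i * Real.sin_sq_add_cos_sq (φ i) - w i * Real.cos (φ i) ^ 2 * hε
      rw [hterm]
      exact mul_nonneg (hw i) (by positivity)
    have := discrim_le_zero hquad
    rw [discrim] at this
    linarith
  rcases abs_cases C with ⟨h, -⟩ | ⟨h, -⟩
  · simpa [h] using hbound 1 (one_pow 2)
  · simpa [h] using hbound (-1) (by norm_num)

theorem abs_lt_of_hasSum_mul_cos (hw : ∀ i, 0 ≤ w i) (hW : HasSum w W)
    (hC : HasSum (fun i => w i * Real.cos (φ i)) C) {j : ι} (hj : 0 < w j)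
    (hsin : Real.sin (φ j) ≠ 0) : |C| < W := by
  have hcos : |Real.cos (φ j)| < 1 := (sq_lt_one_iff_abs_lt_one _).mp (by
    linarith [Real.sin_sq_add_cos_sq (φ j), sq_pos_of_ne_zero hsin])
  refine abs_lt.mpr ⟨hasSum_lt (fun i => ?_) (i := j) ?_ hW.neg hC,
    hasSum_lt (fun i => mul_le_of_le_one_right (hw i) (Real.cos_le_one _)) (i := j)
      (mul_lt_of_lt_one_right hj (lt_of_abs_lt hcos)) hC hW⟩
  · nlinarith [hw i, Real.neg_one_le_cos (φ i)]
  · nlinarith [neg_lt_of_abs_lt hcos]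

end WeightedTrigonometricSums

section OddLogDerivBounds

theorem hasSum_odd_ge_three_inv_sq :
    HasSum (fun n : ℕ => if Even n ∨ n < 3 then (0 : ℝ) else 1 / (n : ℝ) ^ 2)
      (Real.pi ^ 2 / 8 - 1) := by
  have heven : HasSum (fun n : ℕ => if Even n then 1 / (n : ℝ) ^ 2 else 0) (Real.pi ^ 2 / 24) := by
    refine (Function.Injective.hasSum_iff (mul_right_injective₀ two_ne_zero) fun n hn =>
      if_neg fun h => hn ?_).mp ?_
    · obtain ⟨k, rfl⟩ := even_iff_exists_two_mul.mp h
      exact ⟨k, rfl⟩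
    · rw [show Real.pi ^ 2 / 24 = 1 / 4 * (Real.pi ^ 2 / 6) by ring]
      refine (hasSum_zeta_two.mul_left (1 / 4)).congr_fun fun k => ?_
      simp
      ring
  convert! (hasSum_zeta_two.sub heven).sub (hasSum_ite_eq 1 1) using 2 with n
  · rcases lt_or_ge n 3 with h | h
    · interval_cases n <;> simp
    · by_cases h2 : Even n <;> simp [show n ≠ 1 by lia, show ¬n < 3 by lia, h2]
  · ring

theorem div_rpow_le_of_three_le {σ : ℝ} (hσ : 5 / 2 ≤ σ) {n : ℕ} (hn : 3 ≤ n) :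
    (2 / n : ℝ) ^ σ ≤ 0.8165 * (2 / n) ^ 2 := by
  have hn' : (3 : ℝ) ≤ n := by exact_mod_cast hn
  have hle : (2 / n : ℝ) ≤ 2 / 3 := by gcongr
  calc (2 / n : ℝ) ^ σ ≤ (2 / n : ℝ) ^ (1 / 2 + (2 : ℕ) : ℝ) :=
        Real.rpow_le_rpow_of_exponent_ge (by positivity) (by linarith) (by norm_num; exact hσ)
    _ = √(2 / n) * (2 / n) ^ 2 := by
        rw [Real.rpow_add (by positivity), Real.rpow_natCast, Real.sqrt_eq_rpow]
    _ ≤ 0.8165 * (2 / n) ^ 2 := by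
        gcongr
        exact Real.sqrt_le_iff.mpr ⟨by norm_num, hle.trans (by norm_num)⟩

theorem oddMangoldt_div_log_sq_mul_rpow_le {σ : ℝ} (hσ : 5 / 2 ≤ σ) (n : ℕ) :
    oddMangoldt n / Real.log n ^ 2 * (n : ℝ) ^ (-σ) ≤
      2 ^ (-σ) * (0.8165 * 4 / Real.log 3) *
        (if Even n ∨ n < 3 then (0 : ℝ) else 1 / (n : ℝ) ^ 2) := by
  split_ifs with h
  · simp [show oddMangoldt n = 0 from h.elim (if_pos ·) oddMangoldt_eq_zero_of_lt]
  push Not at h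
  have hn : (3 : ℝ) ≤ n := by exact_mod_cast h.2
  have : 0 < Real.log 3 := Real.log_pos (by norm_num)
  have hlog : Real.log 3 ≤ Real.log n := Real.log_le_log (by norm_num) hn
  have hcoeff : oddMangoldt n / Real.log n ^ 2 ≤ 1 / Real.log 3 := calc
    oddMangoldt n / Real.log n ^ 2 ≤ Real.log n / Real.log n ^ 2 := by
        gcongr
        exact oddMangoldt_le_log n
    _ = 1 / Real.log n := by field_simp
    _ ≤ 1 / Real.log 3 := by gcongr
  have hrpow : (n : ℝ) ^ (-σ) = 2 ^ (-σ) * (2 / n : ℝ) ^ σ := by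
    rw [Real.div_rpow two_pos.le n.cast_nonneg, Real.rpow_neg two_pos.le,
      Real.rpow_neg n.cast_nonneg]
    field_simp
  calc oddMangoldt n / Real.log n ^ 2 * (n : ℝ) ^ (-σ)
      ≤ 1 / Real.log 3 * (2 ^ (-σ) * (0.8165 * (2 / n) ^ 2)) := by
        rw [hrpow]
        gcongr
        exact div_rpow_le_of_three_le hσ h.2
    _ = 2 ^ (-σ) * (0.8165 * 4 / Real.log 3) * (1 / n ^ 2) := by ring

theorem summable_oddMangoldt_div_log_sq {σ : ℝ} (hσ : 5 / 2 ≤ σ) :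
    Summable fun n : ℕ => oddMangoldt n / Real.log n ^ 2 * (n : ℝ) ^ (-σ) :=
  .of_nonneg_of_le (fun n => mul_nonneg (div_nonneg (oddMangoldt_nonneg n) (sq_nonneg _))
      (Real.rpow_nonneg n.cast_nonneg _))
    (oddMangoldt_div_log_sq_mul_rpow_le hσ) (hasSum_odd_ge_three_inv_sq.summable.mul_left _)

theorem two_mul_log_two_mul_tsum_le {σ : ℝ} (hσ : 5 / 2 ≤ σ) :
    2 * Real.log 2 * ∑' n : ℕ, oddMangoldt n / Real.log n ^ 2 * (n : ℝ) ^ (-σ) ≤ 2 ^ (-σ) := by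
  have hsum := hasSum_le (oddMangoldt_div_log_sq_mul_rpow_le hσ)
    (summable_oddMangoldt_div_log_sq hσ).hasSum (hasSum_odd_ge_three_inv_sq.mul_left _)
  have hpi : Real.pi ^ 2 ≤ 3.1416 ^ 2 := pow_le_pow_left₀ Real.pi_pos.le Real.pi_lt_d4.le 2
  have hpi' : 3 ^ 2 ≤ Real.pi ^ 2 := pow_le_pow_left₀ (by norm_num) Real.pi_gt_three.le 2
  have hnum : 2 * Real.log 2 * (0.8165 * 4 * (Real.pi ^ 2 / 8 - 1)) ≤ Real.log 3 := calc
    _ ≤ 2 * 0.6931471808 * (0.8165 * 4 * (3.1416 ^ 2 / 8 - 1)) := by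
        have := Real.log_two_lt_d9
        gcongr
        linarith
    _ ≤ Real.log 3 := by linarith [Real.log_three_gt_d9]
  calc _ ≤ 2 * Real.log 2 * (2 ^ (-σ) * (0.8165 * 4 / Real.log 3) * (Real.pi ^ 2 / 8 - 1)) := by
        gcongr
    _ = 2 ^ (-σ) * (2 * Real.log 2 * (0.8165 * 4 * (Real.pi ^ 2 / 8 - 1)) / Real.log 3) := by ring
    _ ≤ 2 ^ (-σ) := mul_le_of_le_one_right (by positivity) (div_le_one_of_le₀ hnum (by positivity))

theorem abs_re_oddLogDeriv_add_le {s : ℂ} (hs : 5 / 2 ≤ s.re) :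
    |(oddLogDeriv s).re| + Real.log 2 * ((oddLog s).im ^ 2 / 2 ^ (-s.re)) ≤
      (oddLogDeriv s.re).re := by
  have hs1 : 1 < s.re := by linarith
  set K := ∑' n : ℕ, oddMangoldt n / Real.log n ^ 2 * (n : ℝ) ^ (-s.re)
  have hquad : (oddLog s).im ^ 2 ≤ 2 * K * ((oddLogDeriv s.re).re - |(oddLogDeriv s).re|) := by
    refine sq_le_two_mul_mul_sub_abs_of_hasSum (w := fun n : ℕ => _)
      (oddMangoldt_mul_rpow_nonneg s.re) (hasSum_oddLogDeriv_ofReal hs1) (hasSum_re_oddLogDeriv hs1)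
      (l := fun n => -(1 / Real.log n)) ?_ ?_
    · convert! hasSum_im_oddLog hs1 using 2
      ring
    · convert! (summable_oddMangoldt_div_log_sq hs).hasSum using 2
      ring
  have habs : |(oddLogDeriv s).re| ≤ (oddLogDeriv s.re).re :=
    (hasSum_re_oddLogDeriv hs1).norm_le_of_bounded (hasSum_oddLogDeriv_ofReal hs1) fun n => by
      rw [norm_mul, Real.norm_of_nonneg (oddMangoldt_mul_rpow_nonneg s.re n)]
      exact mul_le_of_le_one_right (oddMangoldt_mul_rpow_nonneg s.re n) (Real.abs_cos_le_one _)
  rw [← le_sub_iff_add_le', ← mul_div_assoc, div_le_iff₀ (by positivity)]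
  calc Real.log 2 * (oddLog s).im ^ 2
      ≤ 2 * Real.log 2 * K * ((oddLogDeriv s.re).re - |(oddLogDeriv s).re|) := by
        have := mul_le_mul_of_nonneg_left hquad (Real.log_pos one_lt_two).le
        linarith
    _ ≤ 2 ^ (-s.re) * ((oddLogDeriv s.re).re - |(oddLogDeriv s).re|) :=
        mul_le_mul_of_nonneg_right (two_mul_log_two_mul_tsum_le hs) (sub_nonneg.mpr habs)
    _ = _ := mul_comm _ _

theorem sin_mul_log_prime_ne_zero_or {p q : Nat.Primes} (hpq : p ≠ q) {t : ℝ} (ht : t ≠ 0) :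
    Real.sin (t * Real.log p) ≠ 0 ∨ Real.sin (t * Real.log q) ≠ 0 := by
  by_contra! h
  obtain ⟨k, hk⟩ := Real.sin_eq_zero_iff.mp h.1
  obtain ⟨m, hm⟩ := Real.sin_eq_zero_iff.mp h.2
  have hrel : m • Real.log p + (-k) • Real.log q = 0 := mul_left_cancel₀ ht (by
    simp only [zsmul_eq_mul, Int.cast_neg]
    linear_combination m * (-hk) + k * hm)
  have hk0 := ((LinearIndepOn.pair_iff _ hpq).mp
    (linearIndependent_log_primes.linearIndepOn _) m (-k) hrel).2
  rw [neg_eq_zero.mp hk0] at hk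
  have hlog : Real.log p ≠ 0 := (Real.log_pos (by exact_mod_cast p.2.one_lt)).ne'
  exact mul_ne_zero ht hlog (by simpa using hk.symm)

theorem abs_re_oddLogDeriv_lt {s : ℂ} (hs : 1 < s.re) (ht : s.im ≠ 0) :
    |(oddLogDeriv s).re| < (oddLogDeriv s.re).re := by
  have key (p : Nat.Primes) (hp : (p : ℕ) ≠ 2) (hsin : Real.sin (s.im * Real.log p) ≠ 0) :=
    abs_lt_of_hasSum_mul_cos (w := fun n : ℕ => _) (oddMangoldt_mul_rpow_nonneg s.re)
      (hasSum_oddLogDeriv_ofReal hs) (hasSum_re_oddLogDeriv hs)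
      (mul_pos (oddMangoldt_prime_pos p.2 hp)
        (Real.rpow_pos_of_pos (by exact_mod_cast p.2.pos) _)) hsin
  let three : Nat.Primes := ⟨3, Nat.prime_three⟩
  let five : Nat.Primes := ⟨5, Nat.prime_five⟩
  rcases sin_mul_log_prime_ne_zero_or (p := three) (q := five)
    (fun h => by simpa [three, five] using congrArg Subtype.val h) ht with h | h
  · exact key three (by norm_num) h
  · exact key five (by norm_num) h

end OddLogDerivBounds

section EulerFactorGeometry

theorem sin_sq_mul_norm_sq_of_im_exp_mul_eq_zero {w v : ℂ} (h : (Complex.exp w * v).im = 0) :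
    Real.sin w.im ^ 2 * ‖v‖ ^ 2 = v.im ^ 2 := by
  have hphase : Real.cos w.im * v.im + Real.sin w.im * v.re = 0 := by
    rw [Complex.mul_im, Complex.exp_re, Complex.exp_im] at h
    exact (mul_eq_zero.mp (by linear_combination h :
      Real.exp w.re * (Real.cos w.im * v.im + Real.sin w.im * v.re) = 0)).resolve_left
      (Real.exp_pos _).ne'
  rw [← Complex.normSq_eq_norm_sq, Complex.normSq_apply]
  linear_combination (Real.sin w.im * v.re - Real.cos w.im * v.im) * hphase +
    v.im ^ 2 * Real.sin_sq_add_cos_sq w.im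

variable {z : ℂ}

theorem div_one_sub_eq_inv_sub_one (hz : 1 - z ≠ 0) : z / (1 - z) = (1 - z)⁻¹ - 1 := by
  field_simp
  ring

theorem sq_abs_re_div_one_sub_mul_norm {w : ℂ} (hz : 1 - z ≠ 0)
    (h : (Complex.exp w / (1 - z)).im = 0) :
    (|(z / (1 - z)).re| * ‖1 - z‖) ^ 2 = ‖z‖ ^ 2 - Real.sin w.im ^ 2 := by
  have hN : ‖1 - z‖ ≠ 0 := norm_ne_zero_iff.mpr hz
  have him : (z / (1 - z)).im = ((1 - z)⁻¹).im := by
    rw [div_one_sub_eq_inv_sub_one hz, Complex.sub_im, Complex.one_im, sub_zero]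
  have hsin := sin_sq_mul_norm_sq_of_im_exp_mul_eq_zero (v := (1 - z)⁻¹) h
  rw [norm_inv, inv_pow] at hsin
  have hsq : (z / (1 - z)).re ^ 2 + (z / (1 - z)).im ^ 2 = ‖z‖ ^ 2 / ‖1 - z‖ ^ 2 := by
    rw [← div_pow, ← norm_div, ← Complex.normSq_eq_norm_sq, Complex.normSq_apply, sq, sq]
  rw [mul_pow, sq_abs, eq_sub_of_add_eq hsq, him, ← hsin]
  field_simp

theorem norm_one_sub_le (hz : 1 - z ≠ 0) :
    ‖1 - z‖ ≤ 1 + |(z / (1 - z)).re| * ‖1 - z‖ := by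
  have hN : 0 < ‖1 - z‖ := norm_pos_iff.mpr hz
  have hone : 1 ≤ ‖1 - z‖⁻¹ + |(z / (1 - z)).re| := by
    have hre : (z / (1 - z)).re = ((1 - z)⁻¹).re - 1 := by
      rw [div_one_sub_eq_inv_sub_one hz, Complex.sub_re, Complex.one_re]
    have := Complex.re_le_norm (1 - z)⁻¹
    rw [norm_inv] at this
    linarith [neg_abs_le (z / (1 - z)).re]
  calc ‖1 - z‖ = 1 * ‖1 - z‖ := (one_mul _).symm
    _ ≤ (‖1 - z‖⁻¹ + |(z / (1 - z)).re|) * ‖1 - z‖ := by gcongr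
    _ = _ := by rw [add_mul, inv_mul_cancel₀ hN.ne']

theorem div_one_add_sub_div_one_add_lt {q r : ℝ} (hq : 0 ≤ q) (hqr : q < r) :
    r / (1 + r) - q / (1 + q) < (r ^ 2 - q ^ 2) / r := by
  have hr : 0 < r := hq.trans_lt hqr
  have hden : 1 < (1 + r) * (1 + q) := by nlinarith [mul_nonneg hr.le hq]
  calc r / (1 + r) - q / (1 + q) = (r - q) / ((1 + r) * (1 + q)) := by
        rw [div_sub_div _ _ (by positivity) (by positivity)]; ring
    _ < r - q := div_lt_self (sub_pos.mpr hqr) hden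
    _ ≤ (r ^ 2 - q ^ 2) / r := by
        rw [le_div_iff₀ hr]
        nlinarith [mul_nonneg hq (sub_pos.mpr hqr).le]

/-- With `q = |re (z / (1 - z))| * ‖1 - z‖`, the phase condition reads `q² = ‖z‖² - sin² (im w)`,
and `q / (1 + q)` is a lower bound for `|re (z / (1 - z))|`. -/
theorem lt_abs_re_div_one_sub {w : ℂ} {p : ℝ} (hz0 : z ≠ 0) (hz : 1 - z ≠ 0)
    (h : (Complex.exp w / (1 - z)).im = 0) (hp : p < ‖z‖ / (1 + ‖z‖))
    (hpw : p + w.im ^ 2 / ‖z‖ ≤ ‖z‖ / (1 + ‖z‖)) : p < |(z / (1 - z)).re| := by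
  have hr : 0 < ‖z‖ := norm_pos_iff.mpr hz0
  set R := |(z / (1 - z)).re|
  set q := R * ‖1 - z‖
  have hq : 0 ≤ q := by positivity
  have hq2 : q ^ 2 = ‖z‖ ^ 2 - Real.sin w.im ^ 2 := sq_abs_re_div_one_sub_mul_norm hz h
  have hqr : q ≤ ‖z‖ :=
    (sq_le_sq₀ hq hr.le).mp (by linarith [sq_nonneg (Real.sin w.im)])
  have hqR : q / (1 + q) ≤ R := by
    rw [div_le_iff₀ (by positivity)]
    exact mul_le_mul_of_nonneg_left (norm_one_sub_le hz) (abs_nonneg _)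
  refine lt_of_lt_of_le ?_ hqR
  rcases hqr.eq_or_lt with heq | hlt
  · rwa [heq]
  · have hsq : (‖z‖ ^ 2 - q ^ 2) / ‖z‖ ≤ w.im ^ 2 / ‖z‖ := by
      gcongr
      linarith [Real.sin_sq_le_sq (x := w.im)]
    linarith [div_one_add_sub_div_one_add_lt hq hlt]

end EulerFactorGeometry

section TitchmarshFunction

theorem oddLogDeriv_ofReal_re_pos {σ : ℝ} (hσ : 1 < σ) : 0 < (oddLogDeriv σ).re := by
  have hsum := hasSum_oddLogDeriv_ofReal hσ
  rw [← hsum.tsum_eq]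
  exact hsum.summable.tsum_pos (oddMangoldt_mul_rpow_nonneg σ) 3
    (mul_pos (oddMangoldt_prime_pos Nat.prime_three (by norm_num)) (by positivity))

theorem oddLogDeriv_ofReal_re_le {σ σ' : ℝ} (hσ : 1 < σ) (h : σ ≤ σ') :
    (oddLogDeriv σ').re ≤ 3 ^ (-(σ' - σ)) * (oddLogDeriv σ).re := by
  refine hasSum_le (fun n => ?_) (hasSum_oddLogDeriv_ofReal (hσ.trans_le h))
    ((hasSum_oddLogDeriv_ofReal hσ).mul_left _)
  rcases lt_or_ge n 3 with hn | hn
  · simp [oddMangoldt_eq_zero_of_lt hn]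
  have hn0 : (0 : ℝ) < n := by positivity
  calc oddMangoldt n * (n : ℝ) ^ (-σ')
      = (n : ℝ) ^ (-(σ' - σ)) * (oddMangoldt n * (n : ℝ) ^ (-σ)) := by
        rw [mul_left_comm, ← Real.rpow_add hn0]; ring_nf
    _ ≤ 3 ^ (-(σ' - σ)) * (oddMangoldt n * (n : ℝ) ^ (-σ)) :=
        mul_le_mul_of_nonneg_right
          (Real.rpow_le_rpow_of_nonpos (by norm_num) (by exact_mod_cast hn) (by linarith))
          (oddMangoldt_mul_rpow_nonneg σ n)

/-- The function whose value `log 2` characterizes the Titchmarsh constant: Titchmarsh's equation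
with the contribution of the Euler factor at `2` moved to one side. -/
noncomputable def titchmarshFun (σ : ℝ) : ℝ := (1 + 2 ^ σ) * (oddLogDeriv σ).re

theorem titchmarshFun_pos {σ : ℝ} (hσ : 1 < σ) : 0 < titchmarshFun σ :=
  mul_pos (by positivity) (oddLogDeriv_ofReal_re_pos hσ)

theorem titchmarshFun_le {σ σ' : ℝ} (hσ : 1 < σ) (h : σ ≤ σ') :
    titchmarshFun σ' ≤ (2 / 3 : ℝ) ^ (σ' - σ) * titchmarshFun σ := by
  have hgrowth : (1 + 2 ^ σ' : ℝ) ≤ 2 ^ (σ' - σ) * (1 + 2 ^ σ) := by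
    rw [mul_add, ← Real.rpow_add two_pos, sub_add_cancel, mul_one]
    gcongr
    exact Real.one_le_rpow one_le_two (by linarith)
  have hbase : (2 / 3 : ℝ) ^ (σ' - σ) = 2 ^ (σ' - σ) * 3 ^ (-(σ' - σ)) := by
    rw [Real.div_rpow two_pos.le (by norm_num), Real.rpow_neg (by norm_num), div_eq_mul_inv]
  calc titchmarshFun σ'
      ≤ (2 ^ (σ' - σ) * (1 + 2 ^ σ)) * (3 ^ (-(σ' - σ)) * (oddLogDeriv σ).re) :=
        mul_le_mul hgrowth (oddLogDeriv_ofReal_re_le hσ h)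
          (oddLogDeriv_ofReal_re_pos (hσ.trans_le h)).le (by positivity)
    _ = (2 / 3 : ℝ) ^ (σ' - σ) * titchmarshFun σ := by rw [hbase, titchmarshFun]; ring

theorem strictAntiOn_titchmarshFun : StrictAntiOn titchmarshFun (Set.Ioi 1) := by
  intro σ hσ σ' _ h
  exact (titchmarshFun_le hσ h.le).trans_lt (mul_lt_of_lt_one_left (titchmarshFun_pos hσ)
    (Real.rpow_lt_one (by norm_num) (by norm_num) (sub_pos.mpr h)))

theorem continuousOn_titchmarshFun : ContinuousOn titchmarshFun (Set.Ioi 1) := by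
  intro σ hσ
  have hs : 1 < (σ : ℂ).re := hσ
  have habs : LSeries.abscissaOfAbsConv (fun n => (oddMangoldt n : ℂ)) ≤ (1 : ℝ) :=
    LSeries.abscissaOfAbsConv_le_of_forall_lt_LSeriesSummable
      fun y hy => LSeriesSummable_oddMangoldt (by exact_mod_cast hy)
  have hL : ContinuousAt oddLogDeriv σ :=
    (LSeries_hasDerivAt (habs.trans_lt (by exact_mod_cast hs))).continuousAt
  exact ((continuous_const.add (Real.continuous_const_rpow two_ne_zero)).continuousAt.mul
    (Complex.continuous_re.continuousAt.comp
      (hL.comp Complex.continuous_ofReal.continuousAt))).continuousWithinAt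

theorem rpow_five_half {x : ℝ} (hx : 0 ≤ x) : x ^ (5 / 2 : ℝ) = x ^ 2 * √x := by
  rw [show (5 / 2 : ℝ) = (2 : ℕ) + 1 / 2 by norm_num,
    Real.rpow_add_of_nonneg hx (by positivity) (by positivity), Real.rpow_natCast,
    Real.sqrt_eq_rpow]

theorem div_le_oddMangoldt_prime_mul_rpow {p : ℕ} (hp : p.Prime) (h2 : p ≠ 2) {l m : ℝ}
    (hl : l ≤ Real.log p) (hm0 : 0 ≤ m) (hm : p ≤ m ^ 2) :
    l / (p ^ 2 * m) ≤ oddMangoldt p * (p : ℝ) ^ (-(5 / 2 : ℝ)) := by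
  have hp0 : (0 : ℝ) < p := by exact_mod_cast hp.pos
  have hsqrt : √(p : ℝ) ≤ m := Real.sqrt_le_iff.mpr ⟨hm0, hm⟩
  have : 0 ≤ Real.log p := Real.log_natCast_nonneg p
  rw [oddMangoldt, if_neg (Nat.not_even_iff_odd.mpr (hp.odd_of_ne_two h2)),
    ArithmeticFunction.vonMangoldt_apply_prime hp, Real.rpow_neg hp0.le, rpow_five_half hp0.le,
    ← div_eq_mul_inv]
  gcongr

theorem lt_oddLogDeriv_five_half : 0.111 < (oddLogDeriv (5 / 2 : ℝ)).re := by
  have hsum := sum_le_hasSum {3, 5, 7} (fun n _ => oddMangoldt_mul_rpow_nonneg (5 / 2) n)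
    (hasSum_oddLogDeriv_ofReal (by norm_num))
  rw [Finset.sum_insert (by norm_num), Finset.sum_insert (by norm_num), Finset.sum_singleton]
    at hsum
  have hlog3 := Real.log_three_gt_d9
  have hlog5 := Real.log_five_gt_d9
  have hlog7 : Real.log 5 ≤ Real.log 7 := Real.log_le_log (by norm_num) (by norm_num)
  have h3 := div_le_oddMangoldt_prime_mul_rpow (l := 1.0986) (m := 1.7321) Nat.prime_three
    (by norm_num) (by push_cast; linarith) (by norm_num) (by norm_num)
  have h5 := div_le_oddMangoldt_prime_mul_rpow (l := 1.6094) (m := 2.2361) Nat.prime_five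
    (by norm_num) (by push_cast; linarith) (by norm_num) (by norm_num)
  have h7 := div_le_oddMangoldt_prime_mul_rpow (l := 1.6094) (m := 2.6458) Nat.prime_seven
    (by norm_num) (by push_cast; linarith) (by norm_num) (by norm_num)
  norm_num at h3 h5 h7 hsum ⊢
  linarith

theorem log_two_lt_titchmarshFun : Real.log 2 < titchmarshFun (5 / 2) := by
  have hsqrt : (1.4141 : ℝ) ≤ √2 := Real.le_sqrt_of_sq_le (by norm_num)
  calc Real.log 2 < (1 + 2 ^ 2 * 1.4141) * 0.111 := by linarith [Real.log_two_lt_d9]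
    _ ≤ (1 + 2 ^ (5 / 2 : ℝ)) * 0.111 := by rw [rpow_five_half two_pos.le]; gcongr
    _ < titchmarshFun (5 / 2) := by
      rw [titchmarshFun]; gcongr; exact lt_oddLogDeriv_five_half

theorem tendsto_titchmarshFun_atTop : Tendsto titchmarshFun atTop (𝓝 0) := by
  have hdecay : Tendsto (fun σ : ℝ => (2 / 3 : ℝ) ^ (σ - 2) * titchmarshFun 2) atTop (𝓝 0) := by
    simpa [← sub_eq_add_neg] using
      ((tendsto_rpow_atTop_of_base_lt_one _ (by norm_num) (by norm_num)).comp
        (tendsto_atTop_add_const_right atTop (-2 : ℝ) tendsto_id)).mul_const (titchmarshFun 2)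
  refine squeeze_zero' ?_ ?_ hdecay
  · filter_upwards [eventually_gt_atTop 1] with σ hσ using (titchmarshFun_pos hσ).le
  · filter_upwards [eventually_ge_atTop 2] with σ hσ using titchmarshFun_le one_lt_two hσ

theorem exists_titchmarshFun_eq_log_two : ∃ E : ℝ, 5 / 2 < E ∧ titchmarshFun E = Real.log 2 := by
  obtain ⟨M, hMlt, hM⟩ := ((tendsto_titchmarshFun_atTop.eventually
    (gt_mem_nhds (Real.log_pos one_lt_two))).and (eventually_ge_atTop (5 / 2))).exists
  obtain ⟨E, hE, hEq⟩ := intermediate_value_Icc' hM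
    (continuousOn_titchmarshFun.mono fun x hx => lt_of_lt_of_le (by norm_num) hx.1)
    ⟨hMlt.le, log_two_lt_titchmarshFun.le⟩
  refine ⟨E, hE.1.lt_of_ne ?_, hEq⟩
  rintro rfl
  exact log_two_lt_titchmarshFun.ne' hEq

end TitchmarshFunction

section ZetaTwist

/-- The function obtained from `ζ` by multiplying `2 ^ (-s)` in the Euler factor at `2` by `c`. -/
noncomputable def zetaTwist (c s : ℂ) : ℂ := oddZeta s / (1 - c * 2 ^ (-s))

/-- The contribution of the Euler factor at `2` to `-zetaTwist' / zetaTwist`, divided by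
`log 2`. -/
noncomputable def eulerTerm (c s : ℂ) : ℂ := c * 2 ^ (-s) / (1 - c * 2 ^ (-s))

/-- The logarithmic derivative `-zetaTwist' / zetaTwist`. -/
noncomputable def twistLogDeriv (c s : ℂ) : ℂ := oddLogDeriv s + Real.log 2 * eulerTerm c s

variable {c s : ℂ}

theorem norm_mul_two_cpow_neg (hc : ‖c‖ = 1) : ‖c * 2 ^ (-s)‖ = 2 ^ (-s.re) := by
  simpa [hc] using Complex.norm_cpow_eq_rpow_re_of_pos two_pos (-s)

theorem two_rpow_neg_lt_one {σ : ℝ} (hσ : 1 < σ) : (2 : ℝ) ^ (-σ) < 1 :=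
  Real.rpow_lt_one_of_one_lt_of_neg one_lt_two (by linarith)

theorem one_sub_mul_two_cpow_ne_zero (hc : ‖c‖ = 1) (hs : 1 < s.re) : 1 - c * 2 ^ (-s) ≠ 0 :=
  fun h => (two_rpow_neg_lt_one hs).ne (by
    rw [← norm_mul_two_cpow_neg hc, ← sub_eq_zero.mp h, norm_one])

theorem zetaTwist_one (hs : 1 < s.re) : zetaTwist 1 s = riemannZeta s := by
  rw [zetaTwist, oddZeta, one_mul, mul_div_cancel_left₀]
  simpa using one_sub_mul_two_cpow_ne_zero norm_one hs

theorem zetaTwist_eq_LSeries (hc : ‖c‖ = 1) (hs : 1 < s.re) :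
    zetaTwist c s = LSeries (primeTwist 2 c) s := by
  rw [zetaTwist, div_eq_iff (one_sub_mul_two_cpow_ne_zero hc hs), mul_comm]
  exact_mod_cast (LSeries_primeTwist Nat.prime_two hc hs).symm

theorem zetaTwist_ne_zero (hc : ‖c‖ = 1) (hs : 1 < s.re) : zetaTwist c s ≠ 0 :=
  div_ne_zero (oddZeta_ne_zero hs) (one_sub_mul_two_cpow_ne_zero hc hs)

theorem hasDerivAt_zetaTwist (hc : ‖c‖ = 1) (hs : 1 < s.re) :
    HasDerivAt (zetaTwist c) (-twistLogDeriv c s * zetaTwist c s) s := by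
  have hne := one_sub_mul_two_cpow_ne_zero hc hs
  have hfactor : HasDerivAt (fun z : ℂ => 1 - c * (2 : ℂ) ^ (-z))
      (-(c * ((2 : ℂ) ^ (-s) * Complex.log 2 * -1))) s :=
    (((hasDerivAt_neg' s).const_cpow (Or.inl two_ne_zero)).const_mul c).const_sub 1
  refine ((hasDerivAt_oddZeta hs).div hfactor hne).congr_deriv ?_
  rw [twistLogDeriv, eulerTerm, zetaTwist, Complex.ofReal_log two_pos.le, Complex.ofReal_ofNat]
  field_simp
  ring

theorem zetaTwist_one_eventuallyEq (hs : 1 < s.re) : zetaTwist 1 =ᶠ[𝓝 s] riemannZeta := by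
  filter_upwards [isOpen_one_lt_re.mem_nhds hs] with z hz using zetaTwist_one hz

theorem deriv_riemannZeta (hs : 1 < s.re) :
    deriv riemannZeta s = -twistLogDeriv 1 s * riemannZeta s := by
  rw [← (zetaTwist_one_eventuallyEq hs).deriv_eq, (hasDerivAt_zetaTwist norm_one hs).deriv,
    zetaTwist_one hs]

theorem re_deriv_zetaTwist (hc : ‖c‖ = 1) (hs : 1 < s.re) (him : (zetaTwist c s).im = 0) :
    (deriv (zetaTwist c) s).re = -(twistLogDeriv c s).re * (zetaTwist c s).re := by
  rw [(hasDerivAt_zetaTwist hc hs).deriv, Complex.mul_re, him, mul_zero, sub_zero, Complex.neg_re]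

theorem eulerTerm_ofReal (c σ : ℝ) :
    eulerTerm c σ = ((c * 2 ^ (-σ) / (1 - c * 2 ^ (-σ)) : ℝ) : ℂ) := by
  rw [eulerTerm]
  push_cast [Complex.ofReal_cpow two_pos.le]
  rfl

theorem twistLogDeriv_ofReal {σ : ℝ} (hσ : 1 < σ) (c : ℝ) : twistLogDeriv c σ =
    (((oddLogDeriv σ).re + Real.log 2 * (c * 2 ^ (-σ) / (1 - c * 2 ^ (-σ))) : ℝ) : ℂ) := by
  have hre : oddLogDeriv σ = ((oddLogDeriv σ).re : ℂ) :=
    Complex.ext rfl (by rw [oddLogDeriv_ofReal_im hσ, Complex.ofReal_im])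
  rw [twistLogDeriv, eulerTerm_ofReal, Complex.ofReal_add, ← hre, Complex.ofReal_mul]

theorem two_rpow_neg_div_one_add (σ : ℝ) : (2 : ℝ) ^ (-σ) / (1 + 2 ^ (-σ)) = 1 / (1 + 2 ^ σ) := by
  rw [Real.rpow_neg two_pos.le]
  field_simp
  ring

theorem titchmarshFun_le_log_two_iff {σ : ℝ} : titchmarshFun σ ≤ Real.log 2 ↔
    (oddLogDeriv σ).re ≤ Real.log 2 * (2 ^ (-σ) / (1 + 2 ^ (-σ))) := by
  rw [two_rpow_neg_div_one_add, mul_one_div, le_div_iff₀' (by positivity), titchmarshFun]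

theorem isTitchmarshSolution_iff (σ : ℝ) :
    IsTitchmarshSolution σ ↔ 1 < σ ∧ titchmarshFun σ = Real.log 2 := by
  refine and_congr_right fun hσ => ?_
  have hs : 1 < (σ : ℂ).re := hσ
  have hlog := twistLogDeriv_ofReal hσ 1
  rw [Complex.ofReal_one] at hlog
  rw [deriv_riemannZeta hs, mul_div_cancel_right₀ _ (riemannZeta_ne_zero_of_one_lt_re hs), neg_neg,
    hlog, Complex.ofReal_inj, titchmarshFun]
  have hfour : (4 : ℝ) ^ σ = (2 ^ σ) ^ 2 := by
    rw [← Real.rpow_mul_natCast two_pos.le, mul_comm, Nat.cast_two, Real.rpow_mul two_pos.le]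
    norm_num
  have hx : 1 < (2 : ℝ) ^ σ := Real.one_lt_rpow one_lt_two (by linarith)
  rw [hfour, Real.rpow_add two_pos, Real.rpow_one, Real.rpow_neg two_pos.le]
  set x := (2 : ℝ) ^ σ
  have hx1 : x - 1 ≠ 0 := by linarith
  have hpartial : x * 2 / (x ^ 2 - 1) = 1 / (1 + x) + 1 * x⁻¹ / (1 - 1 * x⁻¹) := by
    have : x ^ 2 - 1 ≠ 0 := by nlinarith
    field_simp
    ring
  rw [hpartial, add_mul, mul_comm (Real.log 2), add_left_inj, one_div, eq_comm,
    eq_inv_mul_iff_mul_eq₀ (by positivity)]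

end ZetaTwist

section VerticalTangents

variable {c s : ℂ}

/-- Where `zetaTwist c = exp oddLog / (1 - c * 2 ^ (-s))` is real, its phase forces the Euler factor
at `2` to dominate the remaining ones. -/
theorem abs_re_oddLogDeriv_lt_of_im_zetaTwist_eq_zero (hc : ‖c‖ = 1) (hs : 5 / 2 ≤ s.re)
    (hE : titchmarshFun s.re ≤ Real.log 2) (ht : s.im ≠ 0) (him : (zetaTwist c s).im = 0) :
    |(oddLogDeriv s).re| < Real.log 2 * |(eulerTerm c s).re| := by
  have hs1 : 1 < s.re := by linarith
  have hlog2 : 0 < Real.log 2 := Real.log_pos one_lt_two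
  have hle := titchmarshFun_le_log_two_iff.mp hE
  have hnorm := norm_mul_two_cpow_neg (s := s) hc
  rw [← div_lt_iff₀' hlog2]
  refine lt_abs_re_div_one_sub (w := oddLog s)
    (norm_pos_iff.mp (hnorm ▸ Real.rpow_pos_of_pos two_pos _))
    (one_sub_mul_two_cpow_ne_zero hc hs1) ?_ ?_ ?_
  · rwa [exp_oddLog hs1]
  · rw [hnorm, div_lt_iff₀' hlog2]
    exact (abs_re_oddLogDeriv_lt hs1 ht).trans_le hle
  · have hquad := (abs_re_oddLogDeriv_add_le hs).trans hle
    rw [← div_le_iff₀' hlog2, add_div, mul_div_cancel_left₀ _ hlog2.ne'] at hquad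
    rwa [hnorm]

theorem re_deriv_zetaTwist_ne_zero (hc : ‖c‖ = 1) (hs : 5 / 2 ≤ s.re)
    (hE : titchmarshFun s.re ≤ Real.log 2) (ht : s.im ≠ 0) (him : (zetaTwist c s).im = 0) :
    (deriv (zetaTwist c) s).re ≠ 0 := by
  have hs1 : 1 < s.re := by linarith
  have hlt := abs_re_oddLogDeriv_lt_of_im_zetaTwist_eq_zero hc hs hE ht him
  rw [re_deriv_zetaTwist hc hs1 him]
  refine mul_ne_zero (neg_ne_zero.mpr fun h => hlt.ne ?_)
    fun h => zetaTwist_ne_zero hc hs1 (Complex.ext h him)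
  rw [twistLogDeriv, Complex.add_re, Complex.re_ofReal_mul] at h
  rw [eq_neg_of_add_eq_zero_left h, abs_neg, abs_mul,
    abs_of_pos (Real.log_pos one_lt_two)]

end VerticalTangents

section Fold

open Set

theorem exists_eq_zero_deriv_nonpos {ψ ψ' : ℝ → ℝ} {a b : ℝ} (hab : a ≤ b)
    (hψ : ∀ x ∈ Icc a b, HasDerivAt ψ (ψ' x) x) (ha : 0 < ψ a) (hb : ψ b < 0) :
    ∃ c ∈ Icc a b, ψ c = 0 ∧ ψ' c ≤ 0 := by
  have hcont : ContinuousOn ψ (Icc a b) := HasDerivAt.continuousOn hψ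
  obtain ⟨c, ⟨hc, hc0⟩, hmin⟩ := (isCompact_Icc.of_isClosed_subset
    (hcont.preimage_isClosed_of_isClosed isClosed_Icc isClosed_Iic)
      inter_subset_left).exists_isLeast ⟨b, right_mem_Icc.mpr hab, mem_Iic.mpr hb.le⟩
  have hzero : ψ c = 0 := by
    obtain ⟨x, hx, hx0⟩ := intermediate_value_Icc' hc.1
      (hcont.mono (Icc_subset_Icc_right hc.2)) ⟨hc0, ha.le⟩
    rwa [le_antisymm (hmin ⟨⟨hx.1, hx.2.trans hc.2⟩, hx0.le⟩) hx.2]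
  have hac : a < c := hc.1.lt_of_ne (by rintro rfl; exact ha.ne' hzero)
  refine ⟨c, hc, hzero, ?_⟩
  by_contra! hpos
  have hsign := eventually_nhdsWithin_sign_eq_of_deriv_pos
    ((hψ c hc).deriv.symm ▸ hpos) hzero
  obtain ⟨x, hx, hxac⟩ :=
    ((hsign.filter_mono nhdsWithin_le_nhds).and (Ioo_mem_nhdsLT hac)).exists
  have hxneg : ψ x < 0 := by
    rw [sign_neg (sub_neg.mpr hxac.2)] at hx
    exact sign_eq_neg_one_iff.mp hx
  exact hxac.2.not_ge (hmin ⟨⟨hxac.1.le, hxac.2.le.trans hc.2⟩, hxneg.le⟩)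

theorem continuousAt_im_horizontal {f : ℂ → ℂ} {σ τ : ℝ} (hf : ContinuousAt f ⟨σ, τ⟩) :
    ContinuousAt (fun x : ℝ => (f ⟨x, τ⟩).im) σ := by
  have hline : ContinuousAt (fun x : ℝ => (⟨x, τ⟩ : ℂ)) σ := by
    simp only [Complex.mk_eq_add_mul_I]
    fun_prop
  exact Complex.continuous_im.continuousAt.comp
    (ContinuousAt.comp (f := fun x : ℝ => (⟨x, τ⟩ : ℂ)) hf hline)

theorem hasDerivAt_im_vertical {f : ℂ → ℂ} {f' : ℂ} {σ τ : ℝ} (h : HasDerivAt f f' ⟨σ, τ⟩) :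
    HasDerivAt (fun y : ℝ => (f ⟨σ, y⟩).im) f'.re τ := by
  have hline : HasDerivAt (fun y : ℝ => (⟨σ, y⟩ : ℂ)) Complex.I τ := by
    simpa [Complex.mk_eq_add_mul_I] using
      ((Complex.ofRealCLM.hasDerivAt (x := τ)).mul_const Complex.I).const_add (σ : ℂ)
  exact (Complex.imCLM.hasFDerivAt.comp_hasDerivAt τ (h.comp τ hline)).congr_deriv (by simp)

theorem exists_im_eq_zero_re_deriv_nonpos {f : ℂ → ℂ} {σ p q : ℝ} (hpq : p ≤ q)
    (hf : ∀ τ ∈ Icc p q, DifferentiableAt ℂ f ⟨σ, τ⟩)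
    (hp : 0 < (f ⟨σ, p⟩).im) (hq : (f ⟨σ, q⟩).im < 0) :
    ∃ τ ∈ Icc p q, (f ⟨σ, τ⟩).im = 0 ∧ (deriv f ⟨σ, τ⟩).re ≤ 0 :=
  exists_eq_zero_deriv_nonpos hpq (fun τ hτ => hasDerivAt_im_vertical (hf τ hτ).hasDerivAt) hp hq

theorem eventually_im_pos_and_neg_vertical {f : ℂ → ℂ} {b : ℂ} (hf : DifferentiableAt ℂ f b)
    (him : (f b).im = 0) (hre : (deriv f b).re < 0) :
    ∀ᶠ η in 𝓝[>] (0 : ℝ), 0 < (f ⟨b.re, b.im - η⟩).im ∧ (f ⟨b.re, b.im + η⟩).im < 0 := by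
  have hsign := eventually_nhdsWithin_sign_eq_of_deriv_neg
    (f := fun y : ℝ => (f ⟨b.re, y⟩).im) (x₀ := b.im)
    ((hasDerivAt_im_vertical hf.hasDerivAt).deriv.symm ▸ hre) him
  have hlow : Tendsto (fun η => b.im - η) (𝓝[>] 0) (𝓝 b.im) :=
    ((continuous_const.sub continuous_id).tendsto' 0 _ (sub_zero _)).mono_left nhdsWithin_le_nhds
  have hhigh : Tendsto (fun η => b.im + η) (𝓝[>] 0) (𝓝 b.im) :=
    ((continuous_const.add continuous_id).tendsto' 0 _ (add_zero _)).mono_left nhdsWithin_le_nhds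
  filter_upwards [hlow.eventually hsign, hhigh.eventually hsign, self_mem_nhdsWithin]
    with η hl hh (hη : 0 < η)
  rw [sub_sub_cancel, sign_pos hη] at hl
  rw [sub_add_cancel_left, sign_neg (neg_neg_of_pos hη)] at hh
  exact ⟨sign_eq_one_iff.mp hl, sign_eq_neg_one_iff.mp hh⟩

theorem eventually_exists_im_eq_zero_re_deriv_nonpos {f : ℂ → ℂ} {s : Set ℝ} {p q : ℝ} {b : ℂ}
    (hf : ∀ z ∈ s ×ℂ Icc p q, DifferentiableAt ℂ f z) (hbs : b.re ∈ s) (hb : b.im ∈ Ioo p q)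
    (him : (f b).im = 0) (hre : (deriv f b).re < 0) :
    ∀ᶠ x in 𝓝[s] b.re, ∃ y ∈ Icc p q, (f ⟨x, y⟩).im = 0 ∧ (deriv f ⟨x, y⟩).re ≤ 0 := by
  obtain ⟨η, ⟨hpos, hneg⟩, hη0, hη⟩ := ((eventually_im_pos_and_neg_vertical
    (hf b ⟨hbs, Ioo_subset_Icc_self hb⟩) him hre).and (Ioo_mem_nhdsGT
      (lt_min (sub_pos.mpr hb.1) (sub_pos.mpr hb.2)))).exists
  obtain ⟨hηp, hηq⟩ := lt_min_iff.mp hη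
  have hcont {y : ℝ} (hy : y ∈ Icc p q) :
      ContinuousWithinAt (fun x : ℝ => (f ⟨x, y⟩).im) s b.re :=
    (continuousAt_im_horizontal (hf ⟨b.re, y⟩ ⟨hbs, hy⟩).continuousAt).continuousWithinAt
  have hlow : b.im - η ∈ Icc p q := ⟨by linarith, by linarith [hb.2]⟩
  have hhigh : b.im + η ∈ Icc p q := ⟨by linarith [hb.1], by linarith⟩
  filter_upwards [(hcont hlow).tendsto.eventually_const_lt hpos,
    (hcont hhigh).tendsto.eventually_lt_const hneg, self_mem_nhdsWithin] with x hxpos hxneg hxs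
  obtain ⟨y, hy, hzero⟩ := exists_im_eq_zero_re_deriv_nonpos (by linarith)
    (fun τ hτ => hf _ ⟨hxs, Icc_subset_Icc hlow.1 hhigh.2 hτ⟩) hxpos hxneg
  exact ⟨y, Icc_subset_Icc hlow.1 hhigh.2 hy, hzero⟩

/-- The decreasing zeros of `τ ↦ Im f (σ + iτ)` depend continuously on `σ`. If there is one on the
left side of the box and none on the right side, and none leaves through the horizontal sides, then
the rightmost of them is a point of the curve `Im f = 0` with vertical tangent. -/
theorem exists_im_eq_zero_re_deriv_eq_zero {f : ℂ → ℂ} {a e p q : ℝ} (hae : a ≤ e)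
    (hf : AnalyticOnNhd ℂ f (Icc a e ×ℂ Icc p q))
    (hp : ∀ σ ∈ Icc a e, (f ⟨σ, p⟩).im ≠ 0) (hq : ∀ σ ∈ Icc a e, (f ⟨σ, q⟩).im ≠ 0)
    (hright : ∀ τ ∈ Icc p q, (f ⟨e, τ⟩).im = 0 → 0 < (deriv f ⟨e, τ⟩).re)
    (hleft : ∃ τ ∈ Icc p q, (f ⟨a, τ⟩).im = 0 ∧ (deriv f ⟨a, τ⟩).re ≤ 0) :
    ∃ b ∈ Icc a e ×ℂ Icc p q, (f b).im = 0 ∧ (deriv f b).re = 0 := by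
  set K : Set ℂ := Icc a e ×ℂ Icc p q
  have hK : IsCompact K := isCompact_Icc.reProdIm isCompact_Icc
  have hcont : ContinuousOn (fun s => ((f s).im, (deriv f s).re)) K :=
    (Complex.continuous_im.comp_continuousOn hf.continuousOn).prodMk
      (Complex.continuous_re.comp_continuousOn hf.deriv.continuousOn)
  have hZ : IsCompact (K ∩ (fun s => ((f s).im, (deriv f s).re)) ⁻¹' ({0} ×ˢ Iic 0)) :=
    hK.of_isClosed_subset (hcont.preimage_isClosed_of_isClosed hK.isClosed
      (isClosed_singleton.prod isClosed_Iic)) inter_subset_left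
  obtain ⟨τ, hτ, hzero⟩ := hleft
  obtain ⟨b, ⟨hbK, him, hre⟩, hmax⟩ := hZ.exists_isMaxOn
    ⟨⟨a, τ⟩, ⟨left_mem_Icc.mpr hae, hτ⟩, hzero⟩ Complex.continuous_re.continuousOn
  refine ⟨b, hbK, him, le_antisymm hre ?_⟩
  by_contra! hlt
  have hbe : b.re < e := hbK.1.2.lt_of_ne fun h =>
    (hright b.im hbK.2 (h ▸ him)).not_gt (h ▸ hlt)
  have hb : b.im ∈ Ioo p q := ⟨hbK.2.1.lt_of_ne fun h => hp b.re hbK.1 (h ▸ him),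
    hbK.2.2.lt_of_ne fun h => hq b.re hbK.1 (h ▸ him)⟩
  have hIcc : Icc a e ∈ 𝓝[>] b.re :=
    mem_of_superset (Ioo_mem_nhdsGT hbe) fun x hx => ⟨hbK.1.1.trans hx.1.le, hx.2.le⟩
  obtain ⟨x, ⟨y, hy, hxy⟩, hxI, hbx⟩ := (((eventually_exists_im_eq_zero_re_deriv_nonpos
    (fun z hz => (hf z hz).differentiableAt) hbK.1 hb him hlt).filter_mono
      (nhdsWithin_le_of_mem hIcc)).and (inter_mem hIcc self_mem_nhdsWithin)).exists
  exact not_le_of_gt (mem_Ioi.mp hbx) (hmax (a := (⟨x, y⟩ : ℂ)) ⟨⟨hxI, hy⟩, hxy⟩)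

end Fold

section RightOfTitchmarsh

theorem riemannZeta_re_pos_of_two_le {s : ℂ} (hs : 2 ≤ s.re) : 0 < (riemannZeta s).re := by
  have hζ : HasSum (LSeries.term 1 s) (riemannZeta s) := LSeriesHasSum_one (by linarith)
  have htail : ‖riemannZeta s - 1‖ ≤ Real.pi ^ 2 / 6 - 1 := by
    rw [← (hζ.sub (hasSum_ite_eq 1 1)).tsum_eq]
    refine tsum_of_norm_bounded (hasSum_zeta_two.sub (hasSum_ite_eq 1 1)) fun n => ?_
    rcases n.eq_zero_or_pos with rfl | hn
    · simp
    rcases eq_or_ne n 1 with rfl | hn1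
    · simp
    rw [LSeries.term_of_ne_zero hn.ne', if_neg hn1, if_neg hn1, sub_zero, sub_zero, norm_div,
      Complex.norm_natCast_cpow_of_pos hn, Pi.one_apply, norm_one, ← Real.rpow_natCast]
    gcongr
    · exact_mod_cast hn
    · exact_mod_cast hs
  have hpi : Real.pi ^ 2 ≤ 3.15 ^ 2 := pow_le_pow_left₀ Real.pi_pos.le Real.pi_lt_d2.le 2
  have hre := (abs_le.mp ((Complex.abs_re_le_norm _).trans htail)).1
  rw [Complex.sub_re, Complex.one_re] at hre
  norm_num at hpi
  linarith

theorem re_deriv_riemannZeta_ofReal_neg {σ : ℝ} (hσ : 1 < σ) :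
    (deriv riemannZeta σ).re < 0 := by
  have htwo := two_rpow_neg_lt_one hσ
  have hfactor : 0 < (1 : ℝ) * 2 ^ (-σ) / (1 - 1 * 2 ^ (-σ)) :=
    div_pos (by positivity) (by linarith)
  have hlog := twistLogDeriv_ofReal hσ 1
  rw [Complex.ofReal_one] at hlog
  rw [deriv_riemannZeta hσ, hlog, ← Complex.ofReal_neg, Complex.re_ofReal_mul]
  exact mul_neg_of_neg_of_pos (neg_neg_of_pos (add_pos (oddLogDeriv_ofReal_re_pos hσ)
    (mul_pos (Real.log_pos one_lt_two) hfactor))) (riemannZeta_re_pos_of_one_lt hσ)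

theorem IsZetaTurningPoint.re_lt {E : ℝ} (hE : 5 / 2 ≤ E) (hEq : titchmarshFun E = Real.log 2)
    {b : ℂ} (hb : IsZetaTurningPoint b) : b.re < E := by
  obtain ⟨-, him, hre⟩ := hb
  by_contra! hle
  have hb1 : 1 < b.re := by linarith
  rcases eq_or_ne b.im 0 with hreal | hreal
  · rw [show b = (b.re : ℂ) from Complex.ext rfl hreal] at hre
    exact (re_deriv_riemannZeta_ofReal_neg hb1).ne hre
  · rw [← (zetaTwist_one_eventuallyEq hb1).deriv_eq] at hre
    rw [← zetaTwist_one hb1] at him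
    have hanti := strictAntiOn_titchmarshFun.antitoneOn (show 1 < E by linarith) hb1 hle
    exact re_deriv_zetaTwist_ne_zero norm_one (hE.trans hle) (hanti.trans_eq hEq) hreal him hre

theorem re_deriv_riemannZeta_pos {s : ℂ} (hs : 5 / 2 ≤ s.re)
    (hE : titchmarshFun s.re ≤ Real.log 2) (hneg : ((2 : ℂ) ^ (-s)).re < 0)
    (him : (riemannZeta s).im = 0) : 0 < (deriv riemannZeta s).re := by
  have hs1 : 1 < s.re := by linarith
  have ht : s.im ≠ 0 := fun h => by
    rw [show s = (s.re : ℂ) from Complex.ext rfl h, ← Complex.ofReal_neg, ← Complex.ofReal_ofNat,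
      ← Complex.ofReal_cpow two_pos.le, Complex.ofReal_re] at hneg
    exact hneg.not_gt (by positivity)
  have hterm : (eulerTerm 1 s).re ≤ 0 := by
    rw [eulerTerm, one_mul, Complex.div_re, ← add_div]
    refine div_nonpos_of_nonpos_of_nonneg ?_ (Complex.normSq_nonneg _)
    simp only [Complex.sub_re, Complex.one_re, Complex.sub_im, Complex.one_im, zero_sub]
    nlinarith [sq_nonneg ((2 : ℂ) ^ (-s)).re, sq_nonneg ((2 : ℂ) ^ (-s)).im]
  rw [← zetaTwist_one hs1] at him
  have hlt := abs_re_oddLogDeriv_lt_of_im_zetaTwist_eq_zero norm_one hs hE ht him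
  rw [abs_of_nonpos hterm] at hlt
  rw [← (zetaTwist_one_eventuallyEq hs1).deriv_eq, re_deriv_zetaTwist norm_one hs1 him,
    zetaTwist_one hs1, twistLogDeriv, Complex.add_re, Complex.re_ofReal_mul]
  exact mul_pos (by linarith [(abs_lt.mp hlt).2]) (riemannZeta_re_pos_of_two_le (by linarith))

end RightOfTitchmarsh

section LimitFunction

theorem exists_im_zetaTwist_ne_zero {c : ℂ} (hc : ‖c‖ = 1) {σ : ℝ} (hσ : 5 / 2 ≤ σ)
    (hE : titchmarshFun σ ≤ Real.log 2) {x y : ℝ} (hxy : x < y) (h0 : (0 : ℝ) ∉ Set.Ioo x y) :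
    ∃ τ ∈ Set.Ioo x y, (zetaTwist c ⟨σ, τ⟩).im ≠ 0 := by
  by_contra! hzero
  obtain ⟨τ, hτ⟩ := exists_between hxy
  have hs : 1 < (⟨σ, τ⟩ : ℂ).re := by linarith
  have hconst : (fun y : ℝ => (zetaTwist c ⟨σ, y⟩).im) =ᶠ[𝓝 τ] fun _ => 0 := by
    filter_upwards [Ioo_mem_nhds hτ.1 hτ.2] with u hu using hzero u hu
  refine re_deriv_zetaTwist_ne_zero (s := ⟨σ, τ⟩) hc hσ hE (fun h => h0 (h ▸ hτ)) (hzero τ hτ) ?_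
  rw [← (hasDerivAt_im_vertical
    (hasDerivAt_zetaTwist hc hs).differentiableAt.hasDerivAt).deriv, hconst.deriv_eq, deriv_const]

theorem zetaTwist_neg_one_ofReal {σ : ℝ} (hσ : 1 < σ) : zetaTwist (-1) σ =
    (((1 - 2 ^ (-σ)) * (riemannZeta σ).re / (1 + 2 ^ (-σ)) : ℝ) : ℂ) := by
  have hζ : riemannZeta σ = ((riemannZeta σ).re : ℂ) :=
    Complex.ext rfl (by rw [riemannZeta_im_eq_zero_of_one_lt hσ, Complex.ofReal_im])
  rw [zetaTwist, oddZeta, neg_one_mul, sub_neg_eq_add, Complex.ofReal_div, Complex.ofReal_mul, ← hζ]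
  push_cast [Complex.ofReal_cpow two_pos.le]
  rfl

theorem im_zetaTwist_neg_one_ofReal {σ : ℝ} (hσ : 1 < σ) : (zetaTwist (-1) σ).im = 0 := by
  rw [zetaTwist_neg_one_ofReal hσ, Complex.ofReal_im]

theorem re_deriv_zetaTwist_neg_one_ofReal_neg {σ : ℝ} (hσ : 1 < σ)
    (hlt : Real.log 2 < titchmarshFun σ) : (deriv (zetaTwist (-1)) σ).re < 0 := by
  have hc : ‖(-1 : ℂ)‖ = 1 := by simp
  have hpos : 0 < (zetaTwist (-1) σ).re := by
    rw [zetaTwist_neg_one_ofReal hσ, Complex.ofReal_re]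
    exact div_pos (mul_pos (sub_pos.mpr (two_rpow_neg_lt_one hσ))
      (riemannZeta_re_pos_of_one_lt hσ)) (by positivity)
  have hlog := twistLogDeriv_ofReal hσ (-1)
  rw [Complex.ofReal_neg, Complex.ofReal_one] at hlog
  rw [re_deriv_zetaTwist hc hσ (im_zetaTwist_neg_one_ofReal hσ), hlog, Complex.ofReal_re,
    neg_one_mul, sub_neg_eq_add, neg_div, mul_neg]
  have := lt_of_not_ge (mt titchmarshFun_le_log_two_iff.mpr hlt.not_ge)
  exact mul_neg_of_neg_of_pos (by linarith) hpos

theorem exists_im_zetaTwist_neg_one_pos_and_neg {σ κ : ℝ} (hσ : 1 < σ)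
    (hlt : Real.log 2 < titchmarshFun σ) (hκ : 0 < κ) :
    ∃ η ∈ Set.Ioo 0 κ, 0 < (zetaTwist (-1) ⟨σ, -η⟩).im ∧ (zetaTwist (-1) ⟨σ, η⟩).im < 0 := by
  obtain ⟨η, ⟨hpos, hneg⟩, hη⟩ := ((eventually_im_pos_and_neg_vertical
    (hasDerivAt_zetaTwist (by simp) hσ).differentiableAt (im_zetaTwist_neg_one_ofReal hσ)
    (re_deriv_zetaTwist_neg_one_ofReal_neg hσ hlt)).and (Ioo_mem_nhdsGT hκ)).exists
  exact ⟨η, hη, by simpa using hpos, by simpa using hneg⟩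

theorem exists_im_zetaTwist_ne_zero_box {c : ℂ} (hc : ‖c‖ = 1) {E : ℝ} (hE : 5 / 2 ≤ E)
    (hEq : titchmarshFun E ≤ Real.log 2) {l δ : ℝ} (hl : l < E) (hδ : 0 < δ) :
    ∃ a ∈ Set.Ioo l E, ∃ p ∈ Set.Ioo (-δ) 0, ∃ q ∈ Set.Ioo 0 δ, ∀ σ ∈ Set.Icc a E,
      (zetaTwist c ⟨σ, p⟩).im ≠ 0 ∧ (zetaTwist c ⟨σ, q⟩).im ≠ 0 := by
  obtain ⟨p, hp, hpE⟩ := exists_im_zetaTwist_ne_zero hc hE hEq (neg_neg_of_pos hδ) (by simp)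
  obtain ⟨q, hq, hqE⟩ := exists_im_zetaTwist_ne_zero hc hE hEq hδ (by simp)
  have hcont (τ : ℝ) : ContinuousAt (fun σ : ℝ => (zetaTwist c ⟨σ, τ⟩).im) E :=
    continuousAt_im_horizontal
      (hasDerivAt_zetaTwist hc (show 1 < (⟨E, τ⟩ : ℂ).re by linarith)).continuousAt
  obtain ⟨m, hm, hsub⟩ := exists_Ioc_subset_of_mem_nhds
    (((hcont p).eventually_ne hpE).and ((hcont q).eventually_ne hqE)) ⟨l, hl⟩
  obtain ⟨a, ha, haE⟩ := exists_between (max_lt hl hm)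
  exact ⟨a, ⟨(le_max_left _ _).trans_lt ha, haE⟩, p, hp, q, hq,
    fun σ hσ => hsub ⟨((le_max_right _ _).trans_lt ha).trans_le hσ.1, hσ.2⟩⟩

end LimitFunction

section TurningPointsNearTitchmarsh

theorem eventually_forall_im_ne_zero_of_tendstoUniformlyOn {α : Type*} [TopologicalSpace α]
    {ι : Type*} {l : Filter ι} {F : ι → α → ℂ} {f : α → ℂ} {K : Set α} (hK : IsCompact K)
    (hf : ContinuousOn f K) (hF : TendstoUniformlyOn F f l K) (hne : ∀ x ∈ K, (f x).im ≠ 0) :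
    ∀ᶠ i in l, ∀ x ∈ K, (F i x).im ≠ 0 := by
  obtain ⟨m, hm, hmin⟩ := hK.exists_forall_le' (Complex.continuous_im.comp_continuousOn hf).abs
    fun x hx => abs_pos.mpr (hne x hx)
  filter_upwards [Metric.tendstoUniformlyOn_iff.mp hF m hm] with i hi x hx hzero
  refine (hmin x hx).not_gt (lt_of_le_of_lt ?_ (hi x hx))
  simpa [hzero, dist_eq_norm] using Complex.abs_im_le_norm (f x - F i x)

open Set in
theorem eventually_exists_im_eq_zero_re_deriv_eq_zero {ι : Type*} {l : Filter ι} {F : ι → ℂ → ℂ}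
    {f : ℂ → ℂ} {a e p q u v : ℝ} (hae : a ≤ e) (hpu : p ≤ u) (huv : u ≤ v) (hvq : v ≤ q)
    (hFan : ∀ i, AnalyticOnNhd ℂ (F i) (Icc a e ×ℂ Icc p q))
    (hf : ContinuousOn f (Icc a e ×ℂ Icc p q))
    (hF : TendstoUniformlyOn F f l (Icc a e ×ℂ Icc p q))
    (hp : ∀ σ ∈ Icc a e, (f ⟨σ, p⟩).im ≠ 0) (hq : ∀ σ ∈ Icc a e, (f ⟨σ, q⟩).im ≠ 0)
    (hu : 0 < (f ⟨a, u⟩).im) (hv : (f ⟨a, v⟩).im < 0)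
    (hright : ∀ᶠ i in l, ∀ τ ∈ Icc p q, (F i ⟨e, τ⟩).im = 0 → 0 < (deriv (F i) ⟨e, τ⟩).re) :
    ∀ᶠ i in l, ∃ b ∈ Icc a e ×ℂ Icc p q, (F i b).im = 0 ∧ (deriv (F i) b).re = 0 := by
  have hedge {τ : ℝ} (hτ : τ ∈ Icc p q) (hne : ∀ σ ∈ Icc a e, (f ⟨σ, τ⟩).im ≠ 0) :
      ∀ᶠ i in l, ∀ σ ∈ Icc a e, (F i ⟨σ, τ⟩).im ≠ 0 := by
    have hsub : Icc a e ×ℂ {τ} ⊆ Icc a e ×ℂ Icc p q := by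
      rintro z ⟨hz, rfl⟩
      exact ⟨hz, hτ⟩
    refine (eventually_forall_im_ne_zero_of_tendstoUniformlyOn
      (isCompact_Icc.reProdIm isCompact_singleton) (hf.mono hsub) (hF.mono hsub) ?_).mono
        fun i hi σ hσ => hi ⟨σ, τ⟩ ⟨hσ, rfl⟩
    rintro ⟨σ, _⟩ ⟨hσ, rfl⟩
    exact hne σ hσ
  have him {τ : ℝ} (hτ : τ ∈ Icc p q) :
      Tendsto (fun i => (F i ⟨a, τ⟩).im) l (𝓝 (f ⟨a, τ⟩).im) :=
    (Complex.continuous_im.tendsto _).comp (hF.tendsto_at ⟨left_mem_Icc.mpr hae, hτ⟩)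
  filter_upwards [hedge ⟨le_rfl, hpu.trans (huv.trans hvq)⟩ hp,
    hedge ⟨hpu.trans (huv.trans hvq), le_rfl⟩ hq, hright,
    (him ⟨hpu, huv.trans hvq⟩).eventually_const_lt hu,
    (him ⟨hpu.trans huv, hvq⟩).eventually_lt_const hv] with i hip hiq hiright hiu hiv
  obtain ⟨τ, hτ, hcross⟩ := exists_im_eq_zero_re_deriv_nonpos huv (fun τ hτ =>
    (hFan i _ ⟨left_mem_Icc.mpr hae, hpu.trans hτ.1, hτ.2.trans hvq⟩).differentiableAt) hiu hiv
  exact exists_im_eq_zero_re_deriv_eq_zero hae (hFan i) hip hiq hiright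
    ⟨τ, ⟨hpu.trans hτ.1, hτ.2.trans hvq⟩, hcross⟩

theorem exists_tendstoUniformlyOn_zetaTwist {c : ℂ} (hc : ‖c‖ = 1) :
    ∃ T : ℕ → ℝ, Tendsto (fun k => (2 : ℂ) ^ (-(T k * Complex.I))) atTop (𝓝 c) ∧
      ∀ σ₀ > 1, TendstoUniformlyOn (fun k s => riemannZeta (s + T k * Complex.I)) (zetaTwist c)
        atTop {s | σ₀ ≤ s.re} := by
  obtain ⟨T, hpow, hunif⟩ := exists_tendstoUniformlyOn_riemannZeta_add_mul_I (primeTwist 2 c)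
    fun n hn => norm_primeTwist hc hn
  refine ⟨T, ?_, fun σ₀ hσ₀ => (hunif σ₀ hσ₀).congr_right fun s hs =>
    (zetaTwist_eq_LSeries hc (hσ₀.trans_le hs)).symm⟩
  simpa [primeTwist_self Nat.prime_two] using hpow 2 two_ne_zero

theorem exists_forall_abs_lt_two_cpow_re_neg {ι : Type*} {l : Filter ι} {T : ι → ℝ} (σ : ℝ)
    (hT : Tendsto (fun k => (2 : ℂ) ^ (-(T k * Complex.I))) l (𝓝 (-1))) :
    ∃ δ > 0, ∀ᶠ k in l, ∀ τ : ℝ, |τ| < δ →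
      ((2 : ℂ) ^ (-(⟨σ, τ⟩ + T k * Complex.I))).re < 0 := by
  have hcont : Continuous fun x : ℝ × ℂ => ((2 : ℂ) ^ (-(σ + x.1 * Complex.I)) * x.2).re := by
    fun_prop (disch := simp)
  have hneg : ((2 : ℂ) ^ (-(σ + (0 : ℝ) * Complex.I)) * -1).re < 0 := by
    rw [Complex.ofReal_zero, zero_mul, add_zero, mul_neg_one, ← Complex.ofReal_neg,
      ← Complex.ofReal_ofNat, ← Complex.ofReal_cpow two_pos.le, Complex.neg_re, Complex.ofReal_re]
    exact neg_neg_of_pos (by positivity)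
  have hnear := (hcont.tendsto (0, -1)).eventually_lt_const hneg
  rw [nhds_prod_eq] at hnear
  obtain ⟨P, hP, Q, hQ, hPQ⟩ := eventually_prod_iff.mp hnear
  obtain ⟨δ, hδ, hball⟩ := Metric.eventually_nhds_iff.mp hP
  refine ⟨δ, hδ, (hT.eventually hQ).mono fun k hk τ hτ => ?_⟩
  rw [neg_add, Complex.cpow_add _ _ two_ne_zero, Complex.mk_eq_add_mul_I]
  exact hPQ (hball (by simpa using hτ)) hk

theorem analyticOnNhd_riemannZeta_add_mul_I (T : ℝ) :
    AnalyticOnNhd ℂ (fun s => riemannZeta (s + T * Complex.I)) {s | 1 < s.re} :=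
  DifferentiableOn.analyticOnNhd (fun s (hs : 1 < s.re) =>
    ((differentiableAt_comp_add_const (b := T * Complex.I)).mpr (differentiableAt_riemannZeta
      fun h => hs.ne' (by simpa using congrArg Complex.re h))).differentiableWithinAt)
    isOpen_one_lt_re

theorem exists_turningPoint_near {E : ℝ} (hE : 5 / 2 ≤ E) (hEq : titchmarshFun E = Real.log 2)
    {l : ℝ} (hl : l < E) : ∃ b, IsZetaTurningPoint b ∧ l ≤ b.re := by
  have hc : ‖(-1 : ℂ)‖ = 1 := by simp
  obtain ⟨T, hT, hunif⟩ := exists_tendstoUniformlyOn_zetaTwist hc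
  obtain ⟨δ, hδ, hneg⟩ := exists_forall_abs_lt_two_cpow_re_neg E hT
  obtain ⟨a, ⟨hla, haE⟩, p, ⟨hδp, hp0⟩, q, ⟨hq0, hqδ⟩, hedge⟩ :=
    exists_im_zetaTwist_ne_zero_box hc hE hEq.le (max_lt hl (show 1 < E by linarith)) hδ
  obtain ⟨hla, ha1⟩ := max_lt_iff.mp hla
  obtain ⟨η, ⟨hη0, hη⟩, hηpos, hηneg⟩ := exists_im_zetaTwist_neg_one_pos_and_neg ha1
    (hEq ▸ strictAntiOn_titchmarshFun ha1 (ha1.trans haE) haE) (lt_min (neg_pos.mpr hp0) hq0)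
  obtain ⟨hηp, hηq⟩ := lt_min_iff.mp hη
  have hbox : ∀ s ∈ Set.Icc a E ×ℂ Set.Icc p q, 1 < s.re := fun s hs => ha1.trans_le hs.1.1
  obtain ⟨k, b, hb, him, hre⟩ := (eventually_exists_im_eq_zero_re_deriv_eq_zero haE.le
    (lt_neg_of_lt_neg hηp).le (by linarith) hηq.le
    (fun k => (analyticOnNhd_riemannZeta_add_mul_I (T k)).mono hbox)
    (fun s hs => (hasDerivAt_zetaTwist hc (hbox s hs)).continuousAt.continuousWithinAt)
    ((hunif a ha1).mono fun s hs => hs.1.1)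
    (fun σ hσ => (hedge σ hσ).1) (fun σ hσ => (hedge σ hσ).2) hηpos hηneg
    (hneg.mono fun k hk τ hτ him => by
      rw [deriv_comp_add_const]
      exact re_deriv_riemannZeta_pos (by simpa using hE) (by simpa using hEq.le)
        (hk τ (abs_lt.mpr ⟨hδp.trans_le hτ.1, hτ.2.trans_lt hqδ⟩)) him)).exists
  rw [deriv_comp_add_const] at hre
  refine ⟨b + T k * Complex.I, ⟨fun h => ?_, him, hre⟩, by simpa using hla.le.trans hb.1.1⟩
  simpa [h] using (hbox b hb).trans_eq (show b.re = (b + T k * Complex.I).re by simp)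

end TurningPointsNearTitchmarsh

theorem theorem9p1 :
    ∃ E : ℝ,
      (IsTitchmarshSolution E ∧ ∀ σ : ℝ, IsTitchmarshSolution σ → σ = E) ∧
      (∀ b : ℂ, IsZetaTurningPoint b → b.re < E) ∧
      ∃ b : ℕ → ℂ, (∀ k, IsZetaTurningPoint (b k)) ∧
        Tendsto (fun k => (b k).re) atTop (𝓝 E) := by
  obtain ⟨E, hE, hEq⟩ := exists_titchmarshFun_eq_log_two
  have hE1 : 1 < E := by linarith
  refine ⟨E, ⟨(isTitchmarshSolution_iff E).mpr ⟨hE1, hEq⟩, fun σ hσ => ?_⟩,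
    fun b hb => hb.re_lt hE.le hEq, ?_⟩
  · obtain ⟨hσ1, hσEq⟩ := (isTitchmarshSolution_iff σ).mp hσ
    exact strictAntiOn_titchmarshFun.injOn hσ1 hE1 (hσEq.trans hEq.symm)
  · choose b hb hbE using fun k : ℕ => exists_turningPoint_near hE.le hEq
      (sub_lt_self E (Nat.one_div_pos_of_nat (n := k)))
    refine ⟨b, hb, tendsto_of_tendsto_of_tendsto_of_le_of_le ?_ tendsto_const_nhds hbE
      fun k => ((hb k).re_lt hE.le hEq).le⟩
    simpa using tendsto_one_div_add_atTop_nhds_zero_nat.const_sub E
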